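/- Let $n\ge 2$, let $\gamma_1,\dots,\gamma_{n-1}\ge 1$, and put $\gamma=1+\gamma_1+\dots+\gamma_{n-1}$ and $$\Omega_\gamma=\{x\in\mathbb R^n: 0<x_n<1,\ 0<x_i<x_n^{\gamma_i},\ i=1,\dots,n-1\}.$$ Let $\Omega_n$ be this domain in the case $\gamma_1=\dots=\gamma_{n-1}=1$. For $a>0$ define $\varphi_a:\Omega_n\to\Omega_\gamma$ by $$\varphi_a(x)=\Big(\tfrac{x_1}{x_n}\,x_n^{a\gamma_1},\dots,\tfrac{x_{n-1}}{x_n}\,x_n^{a\gamma_{n-1}},\,x_n^a\Big).$$ Definitions. Let $\Omega,\widetilde\Omega\subset\mathbb R^n$ be domains, let $w:\mathbb R^n\to[0,\infty)$ be a weight and let $1<s<p<\infty$. The space $L^1_p(\Omega,w)$ consists of the locally integrable, weakly differentiable functions $f:\Omega\to\mathbb R$ with finite seminorm $\|f\|_{L^1_p(\Omega,w)}=\big(\int_\Omega|\nabla f|^p w\,dx\big)^{1/p}$, and $L^1_s(\Omega)=L^1_s(\Omega,1)$. A homeomorphism $\varphi$ of $\Omega$ onto $\widetilde\Omega$ is called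 $w$-weighted $(p,s)$-quasiconformal if $\varphi\in W^1_{1,\mathrm{loc}}(\Omega)$, $D\varphi=0$ almost everywhere on $\{x\in\Omega:|J(x,\varphi)|\,w(\varphi(x))=0\}$, and $$K_{p,s}(\varphi;\Omega)=\left(\int_\Omega\left(\frac{|D\varphi(x)|^p}{|J(x,\varphi)|\,w(\varphi(x))}\right)^{\frac{s}{p-s}}dx\right)^{\frac{p-s}{ps}}<\infty ,$$ where $|D\varphi(x)|$ is the operator norm, $J(x,\varphi)=\det D\varphi(x)$ and $0/0=0$. The map $\varphi$ has the Luzin $N$-property if it maps subsets of $\Omega$ of Lebesgue measure zero to sets of measure zero. By $\|\varphi^*\|$ we denote the norm of the composition operator $\varphi^*:L^1_p(\widetilde\Omega,w)\to L^1_s(\Omega)$, $\varphi^*f=f\circ\varphi$, with $\|\varphi^*\|=\infty$ if it is not a bounded operator between these spaces. Theorem. Let $n$, $\gamma_1,\dots,\gamma_{n-1}$ be as above and let $\alpha,a\in\mathbb R$. There is a constant $c_a>0$, depending only on $n,\gamma_1,\dots,\gamma_{n-1},\alpha$ and $a$, such that the following holds for every $p$ with $1<p<\alpha+\gamma$, $-n<\alpha<n(p-1)$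 and $$\max\Big\{0,\frac{n-p}{\alpha+\gamma-p}\Big\}<a<\frac{p(n-1)}{\alpha+\gamma-p}.$$ The domain $\Omega_n$ is a bounded convex Lipschitz domain, $\Omega_\gamma$ is bounded, and $\varphi_a$ has the Luzin $N$-property. Moreover, for every $s$ with $1<s<\dfrac{np}{a(\alpha+\gamma-p)+p}$, the map $\varphi_a$ is an $|x|^\alpha$-weighted $(p,s)$-quasiconformal homeomorphism of $\Omega_n$ onto $\Omega_\gamma$ (in particular $s<p$), and, for the weight $w=|x|^\alpha$, $$\|\varphi_a^*\|\le K_{p,s}(\varphi_a;\Omega_n)\le\frac{\sqrt{\sum_{i=1}^{n-1}(a\gamma_i-1)^2+n-1+a^2}}{\sqrt[p]{a\,c_a}}\left(\frac{p-s}{np-s\,(a(\alpha+\gamma-p)+p)}\right)^{\frac{p-s}{ps}} .$$ -/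

import Mathlib

open MeasureTheory Set Metric
open scoped ENNReal NNReal ContDiff RealInnerProductSpace

noncomputable section

section WeakDerivatives

variable {E F : Type*} [NormedAddCommGroup E] [InnerProductSpace ℝ E] [FiniteDimensional ℝ E]
  [MeasurableSpace E] [BorelSpace E] [NormedAddCommGroup F] [NormedSpace ℝ F]

/-- `Df` is a weak (distributional) derivative of `f` on the open set `Ω`: both are locally
integrable on `Ω`, and `∫_Ω (∂_v ψ) f = - ∫_Ω ψ (Df v)` for all test functions `ψ ∈ C_c^∞(Ω)` and
all directions `v`.  For real valued `f`, `‖Df x‖` is the Euclidean norm of the weak gradient. -/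
structure HasWeakFDerivOn (Ω : Set E) (f : E → F) (Df : E → E →L[ℝ] F) : Prop where
  locallyIntegrableOn : LocallyIntegrableOn f Ω volume
  locallyIntegrableOn_deriv : LocallyIntegrableOn Df Ω volume
  integral_eq : ∀ ψ : E → ℝ, ContDiff ℝ ∞ ψ → HasCompactSupport ψ → tsupport ψ ⊆ Ω → ∀ v : E,
    ∫ x in Ω, (fderiv ℝ ψ x v) • f x = - ∫ x in Ω, ψ x • (Df x v)

/-- `f` is locally integrable and weakly differentiable on `Ω`, with locally integrable weak
derivative; for open `Ω` this is `f ∈ W^1_{1,loc}(Ω)`. -/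
def WeaklyDifferentiableOn (Ω : Set E) (f : E → F) : Prop :=
  ∃ Df : E → E →L[ℝ] F, HasWeakFDerivOn Ω f Df

open Classical in
/-- A weak derivative of `f` on `Ω` (unique almost everywhere on an open set `Ω`); by convention `0`
if `f` is not weakly differentiable. -/
def weakFDeriv (Ω : Set E) (f : E → F) : E → E →L[ℝ] F :=
  if h : WeaklyDifferentiableOn Ω f then h.choose else 0

/-- The seminorm `(∫_Ω |∇f|^p w dx)^{1/p}` of `L^1_p(Ω, w)`. -/
def sobolevSeminorm (p : ℝ) (Ω : Set E) (w : E → ℝ≥0) (f : E → ℝ) : ℝ≥0∞ :=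
  (∫⁻ x in Ω, ‖weakFDeriv Ω f x‖ₑ ^ p * (w x : ℝ≥0∞)) ^ (1 / p)

/-- `f ∈ L^1_p(Ω, w)`: `f` is locally integrable and weakly differentiable on `Ω`, with finite
seminorm. -/
def MemSobolev (p : ℝ) (Ω : Set E) (w : E → ℝ≥0) (f : E → ℝ) : Prop :=
  WeaklyDifferentiableOn Ω f ∧ sobolevSeminorm p Ω w f < ⊤

/-- The norm of the composition operator `φ^* : L^1_p(Ω', w) → L^1_s(Ω)`, `φ^* f = f ∘ φ`: the least
`C` such that every `f ∈ L^1_p(Ω', w)` satisfies `f ∘ φ ∈ L^1_s(Ω)` and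
`‖f ∘ φ‖_{L^1_s(Ω)} ≤ C ‖f‖_{L^1_p(Ω', w)}`.  It is `⊤` if `φ^*` is not a bounded operator between
these spaces (in particular if it does not map the first into the second). -/
def compositionNorm (p s : ℝ) (Ω Ω' : Set E) (w : E → ℝ≥0) (φ : E → E) : ℝ≥0∞ :=
  sInf {C : ℝ≥0∞ | ∀ f : E → ℝ, MemSobolev p Ω' w f →
    MemSobolev s Ω (fun _ => 1) (f ∘ φ) ∧
      sobolevSeminorm s Ω (fun _ => 1) (f ∘ φ) ≤ C * sobolevSeminorm p Ω' w f}

/-- The quantity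
`K_{p,s}(φ; Ω) = (∫_Ω (|Dφ(x)|^p / (|J(x, φ)| w(φ(x))))^{s/(p-s)} dx)^{(p-s)/(ps)}`,
with `|Dφ(x)|` the operator norm and `J(x, φ) = det Dφ(x)`.  The quotient is taken in `[0, ∞]`, with
`0 / 0 = 0` and `c / 0 = ∞` for `c > 0`. -/
def distortionNorm (p s : ℝ) (Ω : Set E) (w : E → ℝ≥0) (φ : E → E) : ℝ≥0∞ :=
  (∫⁻ x in Ω, (‖weakFDeriv Ω φ x‖ₑ ^ p /
    (‖(weakFDeriv Ω φ x).det‖ₑ * (w (φ x) : ℝ≥0∞))) ^ (s / (p - s))) ^ ((p - s) / (p * s))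

/-- `φ` is a mapping of finite `w`-weighted distortion on `Ω`: it is of class `W^1_{1,loc}(Ω)` and
`Dφ = 0` almost everywhere on the set where `|J(x, φ)| w(φ(x)) = 0`. -/
def FiniteWeightedDistortion (Ω : Set E) (w : E → ℝ≥0) (φ : E → E) : Prop :=
  WeaklyDifferentiableOn Ω φ ∧
    ∀ᵐ x ∂(volume.restrict Ω),
      |(weakFDeriv Ω φ x).det| * (w (φ x) : ℝ) = 0 → weakFDeriv Ω φ x = 0

/-- `Ω` is a domain: a nonempty connected open set. -/
def IsDomainSet (Ω : Set E) : Prop := IsOpen Ω ∧ IsConnected Ω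

/-- `φ` is a `w`-weighted `(p, s)`-quasiconformal homeomorphism of the domain `Ω` onto the domain
`Ω'`, `1 < s < p < ∞`. -/
structure IsWeightedQuasiconformal (p s : ℝ) (w : E → ℝ≥0) (Ω Ω' : Set E) (φ : E → E) : Prop where
  one_lt : 1 < s
  lt : s < p
  isDomain_source : IsDomainSet Ω
  isDomain_target : IsDomainSet Ω'
  homeomorph : ∃ h : Ω ≃ₜ Ω', ∀ x : Ω, (h x : E) = φ x
  finiteWeightedDistortion : FiniteWeightedDistortion Ω w φ
  distortionNorm_lt_top : distortionNorm p s Ω w φ < ⊤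

/-- The Luzin `N`-property on `Ω`. -/
def LuzinN (Ω : Set E) (φ : E → E) : Prop :=
  ∀ A : Set E, A ⊆ Ω → volume A = 0 → volume (φ '' A) = 0

/-- `Ω` is a bounded Lipschitz domain: near each boundary point, with respect to some unit vector
`ν`, it is the strict epigraph of a Lipschitz function `h` of the projection
`y - ⟪ν, y⟫ ν` of `y` to the hyperplane orthogonal to `ν`. -/
def IsLipschitzDomain (Ω : Set E) : Prop :=
  IsDomainSet Ω ∧ Bornology.IsBounded Ω ∧
    ∀ x ∈ frontier Ω, ∃ ν : E, ‖ν‖ = 1 ∧ ∃ (L : ℝ≥0) (h : E → ℝ), LipschitzWith L h ∧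
      ∃ r : ℝ, 0 < r ∧ ∀ y ∈ ball x r, (y ∈ Ω ↔ h (y - ⟪ν, y⟫ • ν) < ⟪ν, y⟫)

/-- The power weight `|x|^α`. -/
def powerWeight (α : ℝ) (x : E) : ℝ≥0 := ‖x‖₊ ^ α

end WeakDerivatives

/-- The outward cuspidal domain `Ω_γ` in `ℝ^n`, `n = m + 1`: the points with `0 < x_n < 1` and
`0 < x_i < x_n ^ γ_i` for `i = 1, …, n - 1`. -/
def cuspDomain {m : ℕ} (γ : Fin m → ℝ) : Set (EuclideanSpace ℝ (Fin (m + 1))) :=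
  {x | (0 < x (Fin.last m) ∧ x (Fin.last m) < 1) ∧
    ∀ i : Fin m, 0 < x i.castSucc ∧ x i.castSucc < x (Fin.last m) ^ γ i}

/-- The domain `Ω_n` in `ℝ^n`, `n = m + 1`: the case `γ_1 = … = γ_{n-1} = 1` of `Ω_γ`. -/
def baseDomain (m : ℕ) : Set (EuclideanSpace ℝ (Fin (m + 1))) :=
  cuspDomain (fun _ : Fin m => 1)

/-- The number `γ = 1 + γ_1 + … + γ_{n-1}`, that is, `log (g_1 ⋯ g_{n-1}) / log t + 1` with
`g_i(t) = t ^ γ_i`. -/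
def cuspExponent {m : ℕ} (γ : Fin m → ℝ) : ℝ := 1 + ∑ i, γ i

/-- The map
`φ_a(x) = ((x_1 / x_n) g_1(x_n)^a, …, (x_{n-1} / x_n) g_{n-1}(x_n)^a, x_n^a)`, `g_i(t) = t ^ γ_i`. -/
def cuspMap {m : ℕ} (γ : Fin m → ℝ) (a : ℝ) (x : EuclideanSpace ℝ (Fin (m + 1))) :
    EuclideanSpace ℝ (Fin (m + 1)) :=
  WithLp.toLp 2 (Fin.snoc (α := fun _ => ℝ)
    (fun i : Fin m => x i.castSucc / x (Fin.last m) * (x (Fin.last m) ^ γ i) ^ a)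
    (x (Fin.last m) ^ a))

end

/-!
The map `φ_a` is a smooth diffeomorphism of `Ω_n` onto `Ω_γ`: on the half-space `0 < x_n` it is a
*power shear* `(x_i x_n ^ β_i, x_n ^ b)`, and these maps are closed under composition. Its weak
derivative is therefore the classical one; the derivative is triangular, so that
`J = a x_n ^ (aγ - n)`, while `|Dφ_a| ≤ C x_n ^ (a - 1)`. Since `|y|` is comparable to `y_n` on
`Ω_γ`, the distortion quotient is at most a constant times a power of `x_n`, which is integrated
slice by slice, giving the bound for `K_{p,s}`.

For any smooth diffeomorphism `φ`, the chain rule for weak derivatives follows by duality: the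
integration by parts formula for `f ∘ φ` against a test vector field `T` is the one for `f` against
the Piola transform of `T`. Hölder's inequality with exponents `p / s` and `p / (p - s)` and the
change of variables `y = φ(x)` then give `‖φ^*‖ ≤ K_{p,s}(φ)`.
-/

noncomputable section

section TestFunctions

variable {E F G : Type*} [NormedAddCommGroup E] [NormedSpace ℝ E] [NormedAddCommGroup F]
  [NormedSpace ℝ F] [NormedAddCommGroup G] [NormedSpace ℝ G] {Ω : Set E} {ψ : E → F}

/-- Smooth maps with compact support in `Ω`: scalar test functions for `F = ℝ`, test vector fields
for `F = E`. -/
structure IsTestFunction (Ω : Set E) (ψ : E → F) : Prop where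
  contDiff : ContDiff ℝ ∞ ψ
  hasCompactSupport : HasCompactSupport ψ
  tsupport_subset : tsupport ψ ⊆ Ω

namespace IsTestFunction

theorem differentiable (h : IsTestFunction Ω ψ) : Differentiable ℝ ψ :=
  h.contDiff.differentiable (by simp)

theorem eq_zero_of_notMem (h : IsTestFunction Ω ψ) {x : E} (hx : x ∉ Ω) : ψ x = 0 :=
  image_eq_zero_of_notMem_tsupport fun hx' => hx (h.tsupport_subset hx')

theorem clm_comp (h : IsTestFunction Ω ψ) (L : F →L[ℝ] G) :
    IsTestFunction Ω fun x => L (ψ x) where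
  contDiff := L.contDiff.comp h.contDiff
  hasCompactSupport := h.hasCompactSupport.comp_left (map_zero L)
  tsupport_subset := (tsupport_comp_subset (map_zero L) ψ).trans h.tsupport_subset

theorem fderiv_apply (h : IsTestFunction Ω ψ) (v : E) :
    IsTestFunction Ω fun x => fderiv ℝ ψ x v where
  contDiff := (h.contDiff.fderiv_right (by simp)).clm_apply contDiff_const
  hasCompactSupport := h.hasCompactSupport.fderiv_apply ℝ v
  tsupport_subset := (tsupport_fderiv_apply_subset ℝ v).trans h.tsupport_subset

variable [MeasurableSpace E] {μ : Measure E} {g : E → ℝ} {f : E → F}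

theorem setIntegral_smul (hg : IsTestFunction Ω g) (f : E → F) :
    ∫ x in Ω, g x • f x ∂μ = ∫ x, g x • f x ∂μ :=
  setIntegral_eq_integral_of_forall_compl_eq_zero fun x hx => by
    rw [hg.eq_zero_of_notMem hx, zero_smul]

theorem integrable_smul [OpensMeasurableSpace E] (hg : IsTestFunction Ω g)
    (hf : LocallyIntegrableOn f Ω μ) : Integrable (fun x => g x • f x) μ := by
  have hK : IsCompact (tsupport g) := hg.hasCompactSupport
  have hgf : IntegrableOn (fun x => g x • f x) (tsupport g) μ :=
    (hf.integrableOn_compact_subset hg.tsupport_subset hK).continuousOn_smul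
      hg.contDiff.continuous.continuousOn hK
  exact (integrableOn_iff_integrable_of_support_subset fun x hx =>
    subset_tsupport g fun h0 => hx (by rw [h0, zero_smul])).1 hgf

end IsTestFunction

end TestFunctions

section WeakDerivativeTheory

variable {E F : Type*} [NormedAddCommGroup E] [InnerProductSpace ℝ E] [FiniteDimensional ℝ E]
  [MeasurableSpace E] [BorelSpace E] [NormedAddCommGroup F] [NormedSpace ℝ F]
  {Ω : Set E} {f g : E → F} {D D' : E → E →L[ℝ] F}

theorem ae_eq_of_setIntegral_smul_eq [CompleteSpace F] (hΩ : IsOpen Ω)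
    (hf : LocallyIntegrableOn f Ω) (hg : LocallyIntegrableOn g Ω)
    (h : ∀ ψ : E → ℝ, IsTestFunction Ω ψ → ∫ x in Ω, ψ x • f x = ∫ x in Ω, ψ x • g x) :
    f =ᵐ[volume.restrict Ω] g := by
  have hzero : ∀ᵐ x, x ∈ Ω → (f - g) x = 0 := by
    refine hΩ.ae_eq_zero_of_integral_contDiff_smul_eq_zero (hf.sub hg) fun ψ hψ hc hs => ?_
    have hψΩ : IsTestFunction Ω ψ := ⟨hψ, hc, hs⟩
    simp only [Pi.sub_apply, smul_sub]
    rw [integral_sub (hψΩ.integrable_smul hf) (hψΩ.integrable_smul hg),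
      ← hψΩ.setIntegral_smul f, ← hψΩ.setIntegral_smul g, h ψ hψΩ, sub_self]
  exact (ae_restrict_iff' hΩ.measurableSet).2 (hzero.mono fun x hx hxΩ => sub_eq_zero.1 (hx hxΩ))

theorem locallyIntegrableOn_clm_apply (hΩ : IsOpen Ω) (hD : LocallyIntegrableOn D Ω) (v : E) :
    LocallyIntegrableOn (fun x => D x v) Ω := by
  rw [locallyIntegrableOn_iff hΩ.isLocallyClosed] at hD ⊢
  exact fun K hKΩ hK => (hD K hKΩ hK).apply_continuousLinearMap v

theorem hasWeakFDerivOn_fderiv (hΩ : IsOpen Ω) (hf : ContDiffOn ℝ 1 f Ω) :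
    HasWeakFDerivOn Ω f (fderiv ℝ f) := by
  have hl : LocallyIntegrableOn f Ω := hf.continuousOn.locallyIntegrableOn hΩ.measurableSet
  have hl' : LocallyIntegrableOn (fderiv ℝ f) Ω :=
    (hf.continuousOn_fderiv_of_isOpen hΩ le_rfl).locallyIntegrableOn hΩ.measurableSet
  refine ⟨hl, hl', fun ψ hψ hc hs v => ?_⟩
  have hψΩ : IsTestFunction Ω ψ := ⟨hψ, hc, hs⟩
  rw [(hψΩ.fderiv_apply v).setIntegral_smul, hψΩ.setIntegral_smul,
    integral_smul_fderiv_eq_neg_fderiv_smul_of_integrable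
      ((hψΩ.fderiv_apply v).integrable_smul hl)
      (hψΩ.integrable_smul (locallyIntegrableOn_clm_apply hΩ hl' v)) (hψΩ.integrable_smul hl)
      (fun x _ => hψΩ.differentiable x)
      (fun x hx => (hf.contDiffAt (hΩ.mem_nhds (hs hx))).differentiableAt one_ne_zero),
    neg_neg]

theorem HasWeakFDerivOn.ae_eq [CompleteSpace F] (hΩ : IsOpen Ω) (h : HasWeakFDerivOn Ω f D)
    (h' : HasWeakFDerivOn Ω f D') : D =ᵐ[volume.restrict Ω] D' := by
  have happly : ∀ v : E, (fun x => D x v) =ᵐ[volume.restrict Ω] fun x => D' x v := fun v =>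
    ae_eq_of_setIntegral_smul_eq hΩ (locallyIntegrableOn_clm_apply hΩ h.locallyIntegrableOn_deriv v)
      (locallyIntegrableOn_clm_apply hΩ h'.locallyIntegrableOn_deriv v) fun ψ hψ =>
        neg_injective <| (h.integral_eq ψ hψ.1 hψ.2 hψ.3 v).symm.trans
          (h'.integral_eq ψ hψ.1 hψ.2 hψ.3 v)
  let b := (stdOrthonormalBasis ℝ E).toBasis
  filter_upwards [ae_all_iff.2 fun i => happly (b i)] with x hx
  exact ContinuousLinearMap.coe_injective (b.ext hx)

theorem WeaklyDifferentiableOn.hasWeakFDerivOn (h : WeaklyDifferentiableOn Ω f) :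
    HasWeakFDerivOn Ω f (weakFDeriv Ω f) := by
  rw [weakFDeriv, dif_pos h]
  exact h.choose_spec

theorem HasWeakFDerivOn.weakFDeriv_ae_eq [CompleteSpace F] (hΩ : IsOpen Ω)
    (h : HasWeakFDerivOn Ω f D) : weakFDeriv Ω f =ᵐ[volume.restrict Ω] D :=
  HasWeakFDerivOn.ae_eq hΩ (WeaklyDifferentiableOn.hasWeakFDerivOn ⟨D, h⟩) h

end WeakDerivativeTheory

section Divergence

variable {E F : Type*} [NormedAddCommGroup E] [InnerProductSpace ℝ E] {T : E → E}

/-- The divergence of a vector field, as the trace of its derivative. -/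
def divergence (T : E → E) (x : E) : ℝ :=
  LinearMap.trace ℝ E (fderiv ℝ T x)

theorem divergence_eq_sum_inner {ι : Type*} [Fintype ι] (b : OrthonormalBasis ι ℝ E) {x : E}
    (hT : DifferentiableAt ℝ T x) :
    divergence T x = ∑ i, fderiv ℝ (fun y => ⟪b i, T y⟫) x (b i) := by
  rw [divergence, LinearMap.trace_eq_sum_inner _ b]
  refine Finset.sum_congr rfl fun i _ => ?_
  have hi : HasFDerivAt (fun y => ⟪b i, T y⟫) ((innerSL ℝ (b i)).comp (fderiv ℝ T x)) x :=
    (innerSL ℝ (b i)).hasFDerivAt.comp x hT.hasFDerivAt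
  rw [hi.fderiv]
  rfl

variable [FiniteDimensional ℝ E]

theorem divergence_smul_const {ψ : E → ℝ} {x : E} (hψ : DifferentiableAt ℝ ψ x) (v : E) :
    divergence (fun y => ψ y • v) x = fderiv ℝ ψ x v := by
  rw [divergence, (hψ.hasFDerivAt.smul_const v).fderiv]
  exact LinearMap.trace_smulRight _ _

theorem continuous_divergence (hT : ContDiff ℝ 1 T) : Continuous (divergence T) :=
  (LinearMap.continuous_of_finiteDimensional
    (LinearMap.trace ℝ E ∘ₗ ContinuousLinearMap.coeLM ℝ)).comp (hT.continuous_fderiv one_ne_zero)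

variable [MeasurableSpace E] [BorelSpace E] [NormedAddCommGroup F] [NormedSpace ℝ F] {Ω : Set E}
  {f : E → F} {D : E → E →L[ℝ] F}

theorem HasWeakFDerivOn.integral_divergence_smul (hΩ : IsOpen Ω) (h : HasWeakFDerivOn Ω f D)
    (hT : IsTestFunction Ω T) :
    ∫ x in Ω, divergence T x • f x = -∫ x in Ω, D x (T x) := by
  let b := stdOrthonormalBasis ℝ E
  have hcoord : ∀ i, IsTestFunction Ω fun x => ⟪b i, T x⟫ := fun i => hT.clm_comp (innerSL ℝ (b i))
  have hdiv : ∀ x, divergence T x • f x =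
      ∑ i, fderiv ℝ (fun y => ⟪b i, T y⟫) x (b i) • f x := fun x => by
    rw [divergence_eq_sum_inner b (hT.differentiable x), Finset.sum_smul]
  have hD : ∀ x, D x (T x) = ∑ i, ⟪b i, T x⟫ • D x (b i) := fun x => by
    conv_lhs => rw [← b.sum_repr' (T x), map_sum]
    simp only [map_smul]
  simp_rw [hdiv, hD]
  rw [integral_finsetSum, integral_finsetSum, ← Finset.sum_neg_distrib]
  · exact Finset.sum_congr rfl fun i _ =>
      h.integral_eq _ (hcoord i).contDiff (hcoord i).hasCompactSupport (hcoord i).tsupport_subset _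
  · exact fun i _ => ((hcoord i).integrable_smul
      (locallyIntegrableOn_clm_apply hΩ h.locallyIntegrableOn_deriv (b i))).integrableOn
  · exact fun i _ =>
      (((hcoord i).fderiv_apply (b i)).integrable_smul h.locallyIntegrableOn).integrableOn

theorem hasWeakFDerivOn_of_integral_divergence_smul (hf : LocallyIntegrableOn f Ω)
    (hD : LocallyIntegrableOn D Ω)
    (h : ∀ T : E → E, IsTestFunction Ω T →
      ∫ x in Ω, divergence T x • f x = -∫ x in Ω, D x (T x)) : HasWeakFDerivOn Ω f D := by
  refine ⟨hf, hD, fun ψ hψ hc hs v => ?_⟩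
  have hψΩ : IsTestFunction Ω ψ := ⟨hψ, hc, hs⟩
  have hT := h _ (hψΩ.clm_comp (ContinuousLinearMap.toSpanSingleton ℝ v))
  simpa only [ContinuousLinearMap.toSpanSingleton_apply,
    divergence_smul_const (hψΩ.differentiable _), map_smul] using hT

end Divergence

section SmoothDiffeomorphisms

variable {E : Type*} [NormedAddCommGroup E] [NormedSpace ℝ E]

theorem contDiff_clm_det [FiniteDimensional ℝ E] : ContDiff ℝ ∞ fun A : E →L[ℝ] E => A.det := by
  let b := Module.finBasis ℝ E
  have hentry : ∀ i j, ContDiff ℝ ∞ fun A : E →L[ℝ] E => b.coord i (A (b j)) := fun i j =>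
    (b.coord i).toContinuousLinearMap.contDiff.comp (contDiff_id.clm_apply contDiff_const)
  simp only [ContinuousLinearMap.det, ← LinearMap.det_toMatrix b, Matrix.det_apply,
    LinearMap.toMatrix_apply]
  exact ContDiff.sum fun σ _ => (contDiff_prod fun i _ => hentry (σ i) i).const_smul _

/-- A homeomorphism between open sets which is smooth together with its inverse. -/
structure IsSmoothDiffeo (e : OpenPartialHomeomorph E E) : Prop where
  contDiffOn : ContDiffOn ℝ ∞ e e.source
  contDiffOn_symm : ContDiffOn ℝ ∞ e.symm e.target

/-- The Piola transform of a vector field `T` on the source of `e`: the push-forward of `T` as a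
vector-valued density, extended by zero. -/
def piola (e : OpenPartialHomeomorph E E) (T : E → E) : E → E :=
  e.target.indicator fun y =>
    |(fderiv ℝ e (e.symm y)).det|⁻¹ • fderiv ℝ e (e.symm y) (T (e.symm y))

variable {e : OpenPartialHomeomorph E E} {T : E → E}

theorem support_piola_subset : Function.support (piola e T) ⊆ e '' tsupport T := by
  intro y hy
  have hye : y ∈ e.target := by_contra fun hn => hy (indicator_of_notMem hn _)
  refine ⟨e.symm y, by_contra fun hn => hy ?_, e.right_inv hye⟩
  rw [piola, indicator_of_mem hye, image_eq_zero_of_notMem_tsupport hn, map_zero, smul_zero]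

theorem piola_apply_map {x : E} (hx : x ∈ e.source) :
    piola e T (e x) = |(fderiv ℝ e x).det|⁻¹ • fderiv ℝ e x (T x) := by
  rw [piola, indicator_of_mem (e.map_source hx), e.left_inv hx]

namespace IsSmoothDiffeo

theorem symm (h : IsSmoothDiffeo e) : IsSmoothDiffeo e.symm :=
  ⟨h.contDiffOn_symm, h.contDiffOn⟩

theorem contDiffAt (h : IsSmoothDiffeo e) {x : E} (hx : x ∈ e.source) : ContDiffAt ℝ ∞ e x :=
  h.contDiffOn.contDiffAt (e.open_source.mem_nhds hx)

theorem hasFDerivAt (h : IsSmoothDiffeo e) {x : E} (hx : x ∈ e.source) :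
    HasFDerivAt e (fderiv ℝ e x) x :=
  ((h.contDiffAt hx).differentiableAt (by simp)).hasFDerivAt

theorem det_ne_zero (h : IsSmoothDiffeo e) {x : E} (hx : x ∈ e.source) :
    (fderiv ℝ e x).det ≠ 0 := by
  have hcomp : HasFDerivAt (e.symm ∘ e) ((fderiv ℝ e.symm (e x)).comp (fderiv ℝ e x)) x :=
    (h.symm.hasFDerivAt (e.map_source hx)).comp x (h.hasFDerivAt hx)
  have hid : HasFDerivAt (e.symm ∘ e) (ContinuousLinearMap.id ℝ E) x :=
    (hasFDerivAt_id x).congr_of_eventuallyEq (e.eventually_left_inverse hx)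
  have hdet := congrArg (fun A : E →L[ℝ] E => LinearMap.det (A : E →ₗ[ℝ] E)) (hcomp.unique hid)
  simp only [ContinuousLinearMap.toLinearMap_comp, LinearMap.det_comp,
    ContinuousLinearMap.coe_id, LinearMap.det_id] at hdet
  exact right_ne_zero_of_mul_eq_one hdet

theorem continuousOn_fderiv (h : IsSmoothDiffeo e) : ContinuousOn (fderiv ℝ e) e.source :=
  h.contDiffOn.continuousOn_fderiv_of_isOpen e.open_source (by simp)

theorem continuousOn_inv_abs_det (h : IsSmoothDiffeo e) :
    ContinuousOn (fun x => |(fderiv ℝ e x).det|⁻¹) e.source :=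
  (ContinuousLinearMap.continuous_det.comp_continuousOn h.continuousOn_fderiv).abs.inv₀
    fun _ hx => abs_ne_zero.2 (h.det_ne_zero hx)

variable [FiniteDimensional ℝ E]

theorem contDiffAt_inv_abs_det_symm (h : IsSmoothDiffeo e) {y : E} (hy : y ∈ e.target) :
    ContDiffAt ℝ ∞ (fun y => |(fderiv ℝ e (e.symm y)).det|⁻¹) y := by
  have hdet := h.det_ne_zero (e.map_target hy)
  have hdiff : ContDiffAt ℝ ∞ (fun x => (fderiv ℝ e x).det) (e.symm y) :=
    contDiff_clm_det.contDiffAt.comp _ ((h.contDiffAt (e.map_target hy)).fderiv_right (by simp))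
  exact (((hdiff.abs hdet).inv (abs_ne_zero.2 hdet)).comp y (h.symm.contDiffAt hy) :)

theorem isTestFunction_piola (h : IsSmoothDiffeo e) (hT : IsTestFunction e.source T) :
    IsTestFunction e.target (piola e T) := by
  have hK : IsCompact (e '' tsupport T) :=
    IsCompact.image_of_continuousOn hT.hasCompactSupport (e.continuousOn.mono hT.tsupport_subset)
  have hKe : e '' tsupport T ⊆ e.target := (e.mapsTo.mono_left hT.tsupport_subset).image_subset
  refine ⟨contDiff_iff_contDiffAt.2 fun y => ?_,
    .of_support_subset_isCompact hK support_piola_subset,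
    (closure_minimal support_piola_subset hK.isClosed).trans hKe⟩
  by_cases hy : y ∈ e.target
  · have hη : ContDiffAt ℝ ∞ e.symm y := h.symm.contDiffAt hy
    have hD : ContDiffAt ℝ ∞ (fun y => fderiv ℝ e (e.symm y)) y :=
      ((h.contDiffAt (e.map_target hy)).fderiv_right (m := ∞) (by simp)).comp y hη
    refine ((h.contDiffAt_inv_abs_det_symm hy).smul
      (hD.clm_apply (hT.contDiff.contDiffAt.comp y hη))).congr_of_eventuallyEq ?_
    filter_upwards [e.open_target.mem_nhds hy] with z hz using indicator_of_mem hz _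
  · refine (contDiffAt_const (c := (0 : E))).congr_of_eventuallyEq ?_
    filter_upwards [hK.isClosed.isOpen_compl.mem_nhds fun hyK => hy (hKe hyK)] with z hz
    exact by_contra fun hn => hz (support_piola_subset hn)

variable {F : Type*} [MeasurableSpace E] [BorelSpace E] [NormedAddCommGroup F] [NormedSpace ℝ F]
  {μ : Measure E} [μ.IsAddHaarMeasure]

theorem setIntegral_target (h : IsSmoothDiffeo e) (g : E → F) :
    ∫ y in e.target, g y ∂μ = ∫ x in e.source, |(fderiv ℝ e x).det| • g (e x) ∂μ := by
  rw [← e.image_source_eq_target]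
  exact integral_image_eq_integral_abs_det_fderiv_smul μ e.open_source.measurableSet
    (fun x hx => (h.hasFDerivAt hx).hasFDerivWithinAt) e.injOn g

theorem setLIntegral_target (h : IsSmoothDiffeo e) (g : E → ℝ≥0∞) :
    ∫⁻ y in e.target, g y ∂μ = ∫⁻ x in e.source, ‖(fderiv ℝ e x).det‖ₑ * g (e x) ∂μ := by
  rw [← e.image_source_eq_target]
  simp_rw [Real.enorm_eq_ofReal_abs]
  exact lintegral_image_eq_lintegral_abs_det_fderiv_mul μ e.open_source.measurableSet
    (fun x hx => (h.hasFDerivAt hx).hasFDerivWithinAt) e.injOn g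

theorem setIntegral_smul_comp (h : IsSmoothDiffeo e) (u : E → ℝ) (f : E → F) :
    ∫ x in e.source, u x • f (e x) ∂μ =
      ∫ y in e.target, (|(fderiv ℝ e (e.symm y)).det|⁻¹ * u (e.symm y)) • f y ∂μ := by
  rw [h.setIntegral_target]
  refine setIntegral_congr_fun e.open_source.measurableSet fun x hx => ?_
  simp only [e.left_inv hx, smul_smul, mul_inv_cancel_left₀ (abs_ne_zero.2 (h.det_ne_zero hx))]

theorem locallyIntegrableOn_comp (h : IsSmoothDiffeo e) {g : E → F}
    (hg : LocallyIntegrableOn g e.target μ) : LocallyIntegrableOn (g ∘ e) e.source μ := by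
  refine (locallyIntegrableOn_iff e.open_source.isLocallyClosed).2 fun K hK hKc => ?_
  have himage : IntegrableOn g (e '' K) μ :=
    hg.integrableOn_compact_subset (e.mapsTo.mono_left hK).image_subset
      (hKc.image_of_continuousOn (e.continuousOn.mono hK))
  rw [integrableOn_image_iff_integrableOn_abs_det_fderiv_smul μ hKc.measurableSet
    (fun x hx => (h.hasFDerivAt (hK hx)).hasFDerivWithinAt) (e.injOn.mono hK)] at himage
  exact (himage.continuousOn_smul (h.continuousOn_inv_abs_det.mono hK) hKc).congr_fun
    (fun x hx => inv_smul_smul₀ (abs_ne_zero.2 (h.det_ne_zero (hK hx))) _) hKc.measurableSet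

theorem locallyIntegrableOn_comp_fderiv (h : IsSmoothDiffeo e) {D : E → E →L[ℝ] F}
    (hD : LocallyIntegrableOn D e.target μ) :
    LocallyIntegrableOn (fun x => (D (e x)).comp (fderiv ℝ e x)) e.source μ := by
  refine (locallyIntegrableOn_iff e.open_source.isLocallyClosed).2 fun K hK hKc => ?_
  have hDe : IntegrableOn (D ∘ e) K μ :=
    (h.locallyIntegrableOn_comp hD).integrableOn_compact_subset hK hKc
  have hcont : ContinuousOn (fderiv ℝ e) K := h.continuousOn_fderiv.mono hK
  obtain ⟨C, hC⟩ := hKc.exists_bound_of_continuousOn hcont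
  refine (hDe.norm.mul_const C).mono'
    ((ContinuousLinearMap.compL ℝ E E F).aestronglyMeasurable_comp₂ hDe.aestronglyMeasurable
      (hcont.aestronglyMeasurable hKc.measurableSet)) ?_
  filter_upwards [ae_restrict_mem hKc.measurableSet] with x hx
  exact (ContinuousLinearMap.opNorm_comp_le _ _).trans
    (mul_le_mul_of_nonneg_left (hC x hx) (norm_nonneg _))

end IsSmoothDiffeo

end SmoothDiffeomorphisms

section ChainRule

variable {E F : Type*} [NormedAddCommGroup E] [InnerProductSpace ℝ E] [FiniteDimensional ℝ E]
  [MeasurableSpace E] [BorelSpace E] [NormedAddCommGroup F] [NormedSpace ℝ F]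
  {e : OpenPartialHomeomorph E E} {T : E → E} {f : E → F} {D : E → E →L[ℝ] F}

namespace IsSmoothDiffeo

theorem setIntegral_divergence_piola_smul (h : IsSmoothDiffeo e) (hT : IsTestFunction e.source T)
    (hf : HasWeakFDerivOn e.target f D) :
    ∫ y in e.target, divergence (piola e T) y • f y =
      -∫ x in e.source, D (e x) (fderiv ℝ e x (T x)) := by
  rw [hf.integral_divergence_smul e.open_target (h.isTestFunction_piola hT), h.setIntegral_target]
  refine congrArg Neg.neg (setIntegral_congr_fun e.open_source.measurableSet fun x hx => ?_)
  simp only [piola_apply_map hx, map_smul]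
  exact smul_inv_smul₀ (abs_ne_zero.2 (h.det_ne_zero hx)) _

-- For smooth `T` the identity of densities is dual to the classical chain rule for test functions.
theorem divergence_piola_ae_eq (h : IsSmoothDiffeo e) (hT : IsTestFunction e.source T) :
    divergence (piola e T) =ᵐ[volume.restrict e.target]
      fun y => |(fderiv ℝ e (e.symm y)).det|⁻¹ * divergence T (e.symm y) := by
  have hcont : ContinuousOn (fun y => |(fderiv ℝ e (e.symm y)).det|⁻¹ * divergence T (e.symm y))
      e.target :=
    (h.continuousOn_inv_abs_det.comp e.symm.continuousOn e.symm.mapsTo).mul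
      ((continuous_divergence (hT.contDiff.of_le (by simp))).comp_continuousOn
        e.symm.continuousOn)
  have hpiola : Continuous (divergence (piola e T)) :=
    continuous_divergence ((h.isTestFunction_piola hT).contDiff.of_le (by simp))
  refine ae_eq_of_setIntegral_smul_eq e.open_target
    (hpiola.locallyIntegrable.locallyIntegrableOn _)
    (hcont.locallyIntegrableOn e.open_target.measurableSet) fun g hg => ?_
  have hgw : HasWeakFDerivOn e.target g (fderiv ℝ g) :=
    hasWeakFDerivOn_fderiv e.open_target (hg.contDiff.contDiffOn.of_le (by simp))
  have hgew : HasWeakFDerivOn e.source (g ∘ e) (fderiv ℝ (g ∘ e)) :=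
    hasWeakFDerivOn_fderiv e.open_source
      ((hg.contDiff.comp_contDiffOn h.contDiffOn).of_le (by simp))
  calc ∫ y in e.target, g y • divergence (piola e T) y
      = ∫ y in e.target, divergence (piola e T) y • g y := by simp only [smul_eq_mul, mul_comm]
    _ = -∫ x in e.source, fderiv ℝ g (e x) (fderiv ℝ e x (T x)) :=
        h.setIntegral_divergence_piola_smul hT hgw
    _ = -∫ x in e.source, fderiv ℝ (g ∘ e) x (T x) := by
        refine congrArg Neg.neg (setIntegral_congr_fun e.open_source.measurableSet fun x hx => ?_)
        rw [((hg.differentiable _).hasFDerivAt.comp x (h.hasFDerivAt hx)).fderiv]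
        rfl
    _ = ∫ x in e.source, divergence T x • g (e x) :=
        (hgew.integral_divergence_smul e.open_source hT).symm
    _ = ∫ y in e.target, (|(fderiv ℝ e (e.symm y)).det|⁻¹ * divergence T (e.symm y)) • g y :=
        h.setIntegral_smul_comp _ g
    _ = _ := by simp only [smul_eq_mul, mul_comm]

theorem hasWeakFDerivOn_comp (h : IsSmoothDiffeo e) (hf : HasWeakFDerivOn e.target f D) :
    HasWeakFDerivOn e.source (f ∘ e) fun x => (D (e x)).comp (fderiv ℝ e x) := by
  refine hasWeakFDerivOn_of_integral_divergence_smul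
    (h.locallyIntegrableOn_comp hf.locallyIntegrableOn)
    (h.locallyIntegrableOn_comp_fderiv hf.locallyIntegrableOn_deriv) fun T hT => ?_
  simp only [Function.comp_apply, ContinuousLinearMap.comp_apply]
  rw [← h.setIntegral_divergence_piola_smul hT hf, h.setIntegral_smul_comp]
  refine integral_congr_ae ?_
  filter_upwards [h.divergence_piola_ae_eq hT] with y hy
  rw [hy]

theorem hasWeakFDerivOn (h : IsSmoothDiffeo e) : HasWeakFDerivOn e.source e (fderiv ℝ e) :=
  hasWeakFDerivOn_fderiv e.open_source (h.contDiffOn.of_le (by simp))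

theorem weakFDeriv_ae_eq (h : IsSmoothDiffeo e) :
    weakFDeriv e.source e =ᵐ[volume.restrict e.source] fderiv ℝ e :=
  h.hasWeakFDerivOn.weakFDeriv_ae_eq e.open_source

theorem distortionNorm_eq (h : IsSmoothDiffeo e) (p s : ℝ) (w : E → ℝ≥0) :
    distortionNorm p s e.source w e =
      (∫⁻ x in e.source, (‖fderiv ℝ e x‖ₑ ^ p / (‖(fderiv ℝ e x).det‖ₑ * (w (e x) : ℝ≥0∞))) ^
        (s / (p - s))) ^ ((p - s) / (p * s)) := by
  rw [distortionNorm]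
  congr 1
  refine lintegral_congr_ae ?_
  filter_upwards [h.weakFDeriv_ae_eq] with x hx
  rw [hx]

theorem finiteWeightedDistortion (h : IsSmoothDiffeo e) {w : E → ℝ≥0}
    (hw : ∀ y ∈ e.target, w y ≠ 0) : FiniteWeightedDistortion e.source w e := by
  refine ⟨⟨_, h.hasWeakFDerivOn⟩, ?_⟩
  filter_upwards [h.weakFDeriv_ae_eq, ae_restrict_mem e.open_source.measurableSet]
    with x hx hxe h0
  rw [hx, mul_eq_zero, abs_eq_zero, NNReal.coe_eq_zero] at h0
  exact (h0.elim (h.det_ne_zero hxe) (hw _ (e.map_source hxe))).elim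

theorem luzinN (h : IsSmoothDiffeo e) : LuzinN e.source e := fun _ hA hA0 =>
  addHaar_image_eq_zero_of_differentiableOn_of_addHaar_eq_zero volume
    (fun _ hx => (h.hasFDerivAt (hA hx)).differentiableAt.differentiableWithinAt) hA0

end IsSmoothDiffeo

end ChainRule

section CompositionOperator

theorem lintegral_mul_rpow_le_weighted {α : Type*} [MeasurableSpace α] {μ : Measure α} {p s : ℝ}
    (hs : 0 < s) (hsp : s < p) {A B W : α → ℝ≥0∞} (hA : AEMeasurable A μ) (hB : AEMeasurable B μ)
    (hW : AEMeasurable W μ) (hW0 : ∀ᵐ x ∂μ, W x ≠ 0) (hWtop : ∀ᵐ x ∂μ, W x ≠ ⊤) :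
    (∫⁻ x, (A x * B x) ^ s ∂μ) ^ (1 / s) ≤
      (∫⁻ x, (B x ^ p / W x) ^ (s / (p - s)) ∂μ) ^ ((p - s) / (p * s)) *
        (∫⁻ x, W x * A x ^ p ∂μ) ^ (1 / p) := by
  have hp : 0 < p := hs.trans hsp
  have hps : 0 < p - s := sub_pos.2 hsp
  let f : α → ℝ≥0∞ := fun x => (B x ^ p / W x) ^ (1 / p)
  let g : α → ℝ≥0∞ := fun x => (W x * A x ^ p) ^ (1 / p)
  have hgf : ∀ᵐ x ∂μ, (g * f) x = A x * B x := by
    filter_upwards [hW0, hWtop] with x h0 htop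
    rw [Pi.mul_apply, ← ENNReal.mul_rpow_of_nonneg _ _ (by positivity), mul_right_comm,
      ENNReal.mul_div_cancel h0 htop, ← ENNReal.mul_rpow_of_nonneg _ _ hp.le, ← ENNReal.rpow_mul,
      mul_one_div_cancel hp.ne', ENNReal.rpow_one, mul_comm]
  have hf : ∀ x, f x ^ (p * s / (p - s)) = (B x ^ p / W x) ^ (s / (p - s)) := fun x => by
    rw [← ENNReal.rpow_mul]
    congr 1
    field_simp
  have hg : ∀ x, g x ^ p = W x * A x ^ p := fun x => by
    rw [← ENNReal.rpow_mul, one_div_mul_cancel hp.ne', ENNReal.rpow_one]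
  have hexp : 1 / s = 1 / p + 1 / (p * s / (p - s)) := by
    field_simp
    ring
  have hfm : AEMeasurable f μ := ((hB.pow_const p).div hW).pow_const (1 / p)
  have hgm : AEMeasurable g μ := (hW.mul (hA.pow_const p)).pow_const (1 / p)
  have holder := ENNReal.lintegral_Lp_mul_le_Lq_mul_Lr hs hsp hexp μ hgm hfm
  rw [lintegral_congr_ae (hgf.mono fun x hx => congrArg (· ^ s) hx)] at holder
  simpa only [hf, hg, one_div_div, mul_comm] using holder

variable {E : Type*} [NormedAddCommGroup E] [InnerProductSpace ℝ E] [FiniteDimensional ℝ E]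
  [MeasurableSpace E] [BorelSpace E] {e : OpenPartialHomeomorph E E} {p s : ℝ} {w : E → ℝ≥0}

namespace IsSmoothDiffeo

theorem sobolevSeminorm_comp_le (h : IsSmoothDiffeo e) (hs : 0 < s) (hsp : s < p)
    (hw : Measurable w) (hw0 : ∀ y ∈ e.target, w y ≠ 0) {f : E → ℝ}
    (hf : WeaklyDifferentiableOn e.target f) :
    sobolevSeminorm s e.source (fun _ => 1) (f ∘ e) ≤
      distortionNorm p s e.source w e * sobolevSeminorm p e.target w f := by
  have hmeas := e.open_source.measurableSet
  have hD := hf.hasWeakFDerivOn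
  let A : E → ℝ≥0∞ := fun x => ‖weakFDeriv e.target f (e x)‖ₑ
  let W : E → ℝ≥0∞ := fun x => ‖(fderiv ℝ e x).det‖ₑ * w (e x)
  have hA : AEMeasurable A (volume.restrict e.source) :=
    (h.locallyIntegrableOn_comp hD.locallyIntegrableOn_deriv).aestronglyMeasurable.enorm
  have hB : AEMeasurable (fun x => ‖fderiv ℝ e x‖ₑ) (volume.restrict e.source) :=
    (h.continuousOn_fderiv.aestronglyMeasurable hmeas).enorm
  have hW : AEMeasurable W (volume.restrict e.source) :=
    ((ContinuousLinearMap.continuous_det.comp_continuousOn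
      h.continuousOn_fderiv).aestronglyMeasurable hmeas).enorm.mul
      (hw.comp_aemeasurable (e.continuousOn.aemeasurable hmeas)).coe_nnreal_ennreal
  have hW0 : ∀ᵐ x ∂volume.restrict e.source, W x ≠ 0 := by
    filter_upwards [ae_restrict_mem hmeas] with x hx
    exact mul_ne_zero (enorm_ne_zero.2 (h.det_ne_zero hx))
      (ENNReal.coe_ne_zero.2 (hw0 _ (e.map_source hx)))
  have hchain : ∀ᵐ x ∂volume.restrict e.source,
      ‖weakFDeriv e.source (f ∘ e) x‖ₑ ≤ A x * ‖fderiv ℝ e x‖ₑ := by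
    filter_upwards [(h.hasWeakFDerivOn_comp hD).weakFDeriv_ae_eq e.open_source] with x hx
    exact hx ▸ ContinuousLinearMap.opENorm_comp_le _ _
  have hseminorm : sobolevSeminorm p e.target w f =
      (∫⁻ x in e.source, W x * A x ^ p) ^ (1 / p) := by
    rw [sobolevSeminorm, h.setLIntegral_target]
    simp only [W, A, mul_assoc, mul_comm, mul_left_comm]
  calc sobolevSeminorm s e.source (fun _ => 1) (f ∘ e)
      ≤ (∫⁻ x in e.source, (A x * ‖fderiv ℝ e x‖ₑ) ^ s) ^ (1 / s) := by
        rw [sobolevSeminorm]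
        simp only [ENNReal.coe_one, mul_one]
        refine ENNReal.rpow_le_rpow (lintegral_mono_ae ?_) (by positivity)
        exact hchain.mono fun x hx => ENNReal.rpow_le_rpow hx hs.le
    _ ≤ _ := lintegral_mul_rpow_le_weighted hs hsp hA hB hW hW0
        (.of_forall fun x => ENNReal.mul_ne_top enorm_ne_top ENNReal.coe_ne_top)
    _ = _ := by rw [h.distortionNorm_eq, hseminorm]

theorem compositionNorm_le_distortionNorm (h : IsSmoothDiffeo e) (hs : 0 < s) (hsp : s < p)
    (hw : Measurable w) (hw0 : ∀ y ∈ e.target, w y ≠ 0)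
    (hfin : distortionNorm p s e.source w e < ⊤) :
    compositionNorm p s e.source e.target w e ≤ distortionNorm p s e.source w e := by
  refine sInf_le fun f hf => ?_
  have hle := h.sobolevSeminorm_comp_le hs hsp hw hw0 hf.1
  exact ⟨⟨⟨_, h.hasWeakFDerivOn_comp hf.1.hasWeakFDerivOn⟩,
    hle.trans_lt (ENNReal.mul_lt_top hfin hf.2)⟩, hle⟩

theorem isWeightedQuasiconformal (h : IsSmoothDiffeo e) (hs : 1 < s) (hsp : s < p)
    (hw0 : ∀ y ∈ e.target, w y ≠ 0) (hconn : IsConnected e.source)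
    (hfin : distortionNorm p s e.source w e < ⊤) :
    IsWeightedQuasiconformal p s w e.source e.target e where
  one_lt := hs
  lt := hsp
  isDomain_source := ⟨e.open_source, hconn⟩
  isDomain_target :=
    ⟨e.open_target, e.image_source_eq_target ▸ hconn.image e e.continuousOn⟩
  homeomorph := ⟨e.toHomeomorphSourceTarget, fun _ => rfl⟩
  finiteWeightedDistortion := h.finiteWeightedDistortion hw0
  distortionNorm_lt_top := hfin

end IsSmoothDiffeo

end CompositionOperator

section ConvexDomains

theorem bddBelow_range_add_mul_dist {ι X : Type*} [PseudoMetricSpace X] (L : ℝ≥0) {g : ι → ℝ}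
    (hg : BddBelow (range g)) (c : ι → X) (x : X) :
    BddBelow (range fun i => g i + L * dist x (c i)) :=
  hg.range_mono _ fun _ => le_add_of_nonneg_right (by positivity)

theorem lipschitzWith_iInf_add_mul_dist {ι X : Type*} [Nonempty ι] [PseudoMetricSpace X]
    (L : ℝ≥0) {g : ι → ℝ} (hg : BddBelow (range g)) (c : ι → X) :
    LipschitzWith L fun x => ⨅ i, (g i + L * dist x (c i)) := by
  refine LipschitzWith.of_le_add_mul L fun x y => sub_le_iff_le_add.1 (le_ciInf fun i => ?_)
  calc (⨅ j, (g j + L * dist x (c j))) - L * dist x y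
      ≤ g i + L * dist x (c i) - L * dist x y :=
        sub_le_sub_right (ciInf_le (bddBelow_range_add_mul_dist L hg c x) i) _
    _ ≤ g i + L * dist y (c i) := by
        have := mul_le_mul_of_nonneg_left (dist_triangle x y (c i)) L.coe_nonneg
        linarith

variable {E : Type*} [NormedAddCommGroup E]

theorem mem_of_convex_of_sub_eq [NormedSpace ℝ E] {Ω : Set E} (hΩ : Convex ℝ Ω) {x y y' z k : E}
    {ρ μ : ℝ} (hz : ball z ρ ⊆ Ω) (hy' : y' ∈ Ω) (hy : y ∈ ball x (ρ / 2)) (hμ : 0 < μ)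
    (hk : 2 * ‖k‖ < μ * ρ) (hsub : y - y' = μ • (z - x) + k) : y ∈ Ω := by
  have htop : y + (z - x) + μ⁻¹ • k ∈ Ω := by
    refine hz (mem_ball_iff_norm.2 ?_)
    have hk' : ‖μ⁻¹ • k‖ < ρ / 2 := by
      rw [norm_smul, norm_inv, Real.norm_of_nonneg hμ.le, inv_mul_lt_iff₀ hμ]
      linarith
    calc ‖y + (z - x) + μ⁻¹ • k - z‖ = ‖(y - x) + μ⁻¹ • k‖ := by congr 1; abel
      _ ≤ ‖y - x‖ + ‖μ⁻¹ • k‖ := norm_add_le _ _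
      _ < ρ := by linarith [mem_ball_iff_norm.1 hy]
  have hcomb : y = (1 + μ)⁻¹ • y' + (μ * (1 + μ)⁻¹) • (y + (z - x) + μ⁻¹ • k) := by
    have hk_eq : k = y - y' - μ • (z - x) := eq_sub_of_add_eq' hsub.symm
    rw [hk_eq]
    match_scalars <;> field_simp <;> ring
  rw [hcomb]
  exact hΩ hy' htop (by positivity) (by positivity) (by field_simp)

variable [InnerProductSpace ℝ E]

theorem mem_iff_exists_inner_add_lt_of_convex {Ω : Set E} (hopen : IsOpen Ω) (hconv : Convex ℝ Ω)
    {x y z ν : E} {ρ c : ℝ} (hρ : 0 < ρ) (hc : 0 < c) (hz : ball z ρ ⊆ Ω) (hν : ‖ν‖ = 1)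
    (hzx : z - x = c • ν) (hy : y ∈ ball x (ρ / 2)) :
    y ∈ Ω ↔ ∃ y' ∈ Ω,
      ⟪ν, y'⟫ + 2 * c / ρ * dist (y - ⟪ν, y⟫ • ν) (y' - ⟪ν, y'⟫ • ν) < ⟪ν, y⟫ := by
  refine ⟨fun hyΩ => ?_, fun ⟨y', hy', hlt⟩ => ?_⟩
  · obtain ⟨δ, hδ, hball⟩ := Metric.isOpen_iff.1 hopen y hyΩ
    have hinner : ⟪ν, y - (δ / 2) • ν⟫ = ⟪ν, y⟫ - δ / 2 := by
      rw [inner_sub_right, real_inner_smul_right, real_inner_self_eq_norm_sq, hν]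
      ring
    refine ⟨y - (δ / 2) • ν, hball ?_, ?_⟩
    · rw [mem_ball_iff_norm, sub_sub_cancel_left, norm_neg, norm_smul, hν, mul_one,
        Real.norm_of_nonneg (half_pos hδ).le]
      exact half_lt_self hδ
    · rw [hinner, sub_smul, sub_sub_sub_cancel_right, dist_self, mul_zero, add_zero]
      exact sub_lt_self _ (half_pos hδ)
  · set k := (y - ⟪ν, y⟫ • ν) - (y' - ⟪ν, y'⟫ • ν) with hk
    rw [dist_eq_norm, ← hk, ← lt_sub_iff_add_lt', ← inner_sub_right] at hlt
    have hpos : 0 < ⟪ν, y - y'⟫ := lt_of_le_of_lt (by positivity) hlt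
    refine mem_of_convex_of_sub_eq hconv (μ := ⟪ν, y - y'⟫ / c) hz hy' hy (by positivity) ?_
      (k := k) ?_
    · rw [div_mul_eq_mul_div, lt_div_iff₀ hc]
      rw [div_mul_eq_mul_div, div_lt_iff₀ hρ] at hlt
      linarith
    · rw [hzx, smul_smul, div_mul_cancel₀ _ hc.ne', hk, inner_sub_right, sub_smul]
      abel

-- Near a point outside `Ω`, the cones with vertex in `Ω` that open away from an interior ball stay
-- in `Ω`, so `Ω` is the epigraph of the lower envelope of these cones.
theorem exists_lipschitzWith_mem_iff_of_convex {Ω : Set E} (hopen : IsOpen Ω)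
    (hconv : Convex ℝ Ω) (hbdd : Bornology.IsBounded Ω) (hne : Ω.Nonempty) {x : E} (hx : x ∉ Ω) :
    ∃ ν : E, ‖ν‖ = 1 ∧ ∃ (L : ℝ≥0) (h : E → ℝ), LipschitzWith L h ∧
      ∃ r : ℝ, 0 < r ∧ ∀ y ∈ ball x r, (y ∈ Ω ↔ h (y - ⟪ν, y⟫ • ν) < ⟪ν, y⟫) := by
  obtain ⟨z, hz⟩ := hne
  obtain ⟨ρ, hρ, hzρ⟩ := Metric.isOpen_iff.1 hopen z hz
  have hzx : z - x ≠ 0 := sub_ne_zero.2 fun hzx => hx (hzx ▸ hz)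
  have hc : 0 < ‖z - x‖ := norm_pos_iff.2 hzx
  set ν : E := ‖z - x‖⁻¹ • (z - x)
  have hν : ‖ν‖ = 1 := norm_smul_inv_norm hzx
  have hzxν : z - x = ‖z - x‖ • ν := (smul_inv_smul₀ hc.ne' _).symm
  let L : ℝ≥0 := ⟨2 * ‖z - x‖ / ρ, by positivity⟩
  have : Nonempty Ω := ⟨⟨z, hz⟩⟩
  have hbelow : BddBelow (range fun y' : Ω => ⟪ν, (y' : E)⟫) := by
    obtain ⟨R, hR⟩ := hbdd.exists_norm_le
    refine ⟨-R, forall_mem_range.2 fun y' => neg_le_of_abs_le ?_⟩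
    simpa only [hν, one_mul] using (abs_real_inner_le_norm ν y').trans
      (mul_le_mul_of_nonneg_left (hR y' y'.2) (norm_nonneg ν))
  have hL := lipschitzWith_iInf_add_mul_dist L hbelow fun y' : Ω => (y' : E) - ⟪ν, (y' : E)⟫ • ν
  refine ⟨ν, hν, L, _, hL, ρ / 2, half_pos hρ, fun y hy => ?_⟩
  rw [mem_iff_exists_inner_add_lt_of_convex hopen hconv hρ hc hzρ hν hzxν hy,
    ciInf_lt_iff (bddBelow_range_add_mul_dist L hbelow _ _), Subtype.exists]
  simp only [exists_prop]
  rfl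

theorem isLipschitzDomain_of_convex {Ω : Set E} (hopen : IsOpen Ω) (hconv : Convex ℝ Ω)
    (hbdd : Bornology.IsBounded Ω) (hne : Ω.Nonempty) : IsLipschitzDomain Ω :=
  ⟨⟨hopen, hconv.isConnected hne⟩, hbdd, fun _ hx =>
    exists_lipschitzWith_mem_iff_of_convex hopen hconv hbdd hne (hopen.frontier_eq ▸ hx).2⟩

end ConvexDomains

section CuspGeometry

variable {m : ℕ} {γ : Fin m → ℝ} {x : EuclideanSpace ℝ (Fin (m + 1))}

theorem norm_le_sqrt_mul_of_abs_apply_le {ι : Type*} [Fintype ι] {x : EuclideanSpace ℝ ι} {c : ℝ}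
    (hc : 0 ≤ c) (h : ∀ i, |x i| ≤ c) : ‖x‖ ≤ √(Fintype.card ι) * c := by
  rw [EuclideanSpace.norm_eq]
  refine Real.sqrt_le_iff.2 ⟨by positivity, ?_⟩
  calc ∑ i, ‖x i‖ ^ 2 ≤ ∑ _i : ι, c ^ 2 :=
        Finset.sum_le_sum fun i _ => pow_le_pow_left₀ (norm_nonneg _) (h i) 2
    _ = (√(Fintype.card ι) * c) ^ 2 := by
        rw [Finset.sum_const, Finset.card_univ, nsmul_eq_mul, mul_pow, Real.sq_sqrt (by positivity)]

theorem apply_le_norm {ι : Type*} [Fintype ι] (x : EuclideanSpace ℝ ι) (i : ι) : x i ≤ ‖x‖ :=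
  (Real.le_norm_self _).trans (PiLp.norm_apply_le x i)

theorem mem_baseDomain : x ∈ baseDomain m ↔ (0 < x (Fin.last m) ∧ x (Fin.last m) < 1) ∧
    ∀ i : Fin m, 0 < x i.castSucc ∧ x i.castSucc < x (Fin.last m) := by
  simp only [baseDomain, cuspDomain, Real.rpow_one, mem_ofPred_eq]

theorem toLp_snoc_mem_cuspDomain {y : Fin m → ℝ} {t : ℝ} :
    WithLp.toLp 2 (Fin.snoc (α := fun _ => ℝ) y t) ∈ cuspDomain γ ↔
      t ∈ Ioo 0 1 ∧ y ∈ univ.pi fun i => Ioo 0 (t ^ γ i) := by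
  simp only [cuspDomain, mem_ofPred_eq, Fin.snoc_last, Fin.snoc_castSucc, mem_univ_pi, mem_Ioo]

theorem isOpen_cuspDomain (γ : Fin m → ℝ) : IsOpen (cuspDomain γ) := by
  refine isOpen_iff_eventually.2 fun x ⟨⟨h0, h1⟩, hx⟩ => ?_
  have hcont : ∀ j, ContinuousAt (fun y : EuclideanSpace ℝ (Fin (m + 1)) => y j) x := fun j =>
    (EuclideanSpace.proj j).continuous.continuousAt
  exact ((continuousAt_const.eventually_lt (hcont _) h0).and
    ((hcont _).eventually_lt continuousAt_const h1)).and (Filter.eventually_all.2 fun i =>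
      (continuousAt_const.eventually_lt (hcont _) (hx i).1).and
        ((hcont _).eventually_lt ((hcont _).rpow_const (Or.inl h0.ne')) (hx i).2))

theorem isBounded_cuspDomain (hγ : ∀ i, 0 ≤ γ i) : Bornology.IsBounded (cuspDomain γ) := by
  suffices h : ∀ x ∈ cuspDomain γ, ∀ j, |x j| ≤ 1 from isBounded_iff_forall_norm_le.2
    ⟨_, fun x hx => norm_le_sqrt_mul_of_abs_apply_le zero_le_one (h x hx)⟩
  intro x hx j
  induction j using Fin.lastCases with
  | last => exact (abs_of_pos hx.1.1).trans_le hx.1.2.le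
  | cast i =>
    exact (abs_of_pos (hx.2 i).1).trans_le
      ((hx.2 i).2.le.trans (Real.rpow_le_one hx.1.1.le hx.1.2.le (hγ i)))

theorem norm_pos_of_mem_cuspDomain (hx : x ∈ cuspDomain γ) : 0 < ‖x‖ :=
  hx.1.1.trans_le (apply_le_norm x _)

theorem norm_le_of_mem_cuspDomain (hγ : ∀ i, 1 ≤ γ i) (hx : x ∈ cuspDomain γ) :
    ‖x‖ ≤ √(m + 1) * x (Fin.last m) := by
  obtain ⟨⟨h0, h1⟩, hi⟩ := hx
  have hcoord : ∀ j, |x j| ≤ x (Fin.last m) := fun j => by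
    induction j using Fin.lastCases with
    | last => exact (abs_of_pos h0).le
    | cast i =>
      refine (abs_of_pos (hi i).1).trans_le ((hi i).2.le.trans ?_)
      simpa only [Real.rpow_one] using Real.rpow_le_rpow_of_exponent_ge h0 h1.le (hγ i)
  simpa only [Fintype.card_fin, Nat.cast_add, Nat.cast_one] using
    norm_le_sqrt_mul_of_abs_apply_le h0.le hcoord

theorem nonempty_baseDomain (m : ℕ) : (baseDomain m).Nonempty := by
  refine ⟨WithLp.toLp 2 (Fin.snoc (α := fun _ => ℝ) (fun _ => 1 / 4) (1 / 2)), ?_⟩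
  simp only [mem_baseDomain, Fin.snoc_last, Fin.snoc_castSucc]
  norm_num

theorem convex_baseDomain (m : ℕ) : Convex ℝ (baseDomain m) := by
  intro x hx y hy a b ha hb hab
  rw [mem_baseDomain] at hx hy ⊢
  have hlt : ∀ {u u' v v' : ℝ}, u < u' → v < v' → a * u + b * v < a * u' + b * v' :=
    fun hu hv => by
      rcases ha.eq_or_lt with rfl | ha
      · simpa only [zero_mul, zero_add, (zero_add b).symm.trans hab, one_mul] using hv
      · exact add_lt_add_of_lt_of_le (mul_lt_mul_of_pos_left hu ha)
          (mul_le_mul_of_nonneg_left hv.le hb)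
  simp only [PiLp.add_apply, PiLp.smul_apply, smul_eq_mul]
  refine ⟨⟨?_, ?_⟩, fun i => ⟨?_, hlt (hx.2 i).2 (hy.2 i).2⟩⟩
  · simpa only [mul_zero, add_zero] using hlt hx.1.1 hy.1.1
  · simpa only [mul_one, hab] using hlt hx.1.2 hy.1.2
  · simpa only [mul_zero, add_zero] using hlt (hx.2 i).1 (hy.2 i).1

theorem isLipschitzDomain_baseDomain (m : ℕ) : IsLipschitzDomain (baseDomain m) :=
  isLipschitzDomain_of_convex (isOpen_cuspDomain _) (convex_baseDomain m)
    (isBounded_cuspDomain fun _ => zero_le_one) (nonempty_baseDomain m)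

theorem min_one_rpow_mul_rpow_le {t r K : ℝ} (ht : 0 < t) (htr : t ≤ r) (hr : r ≤ K * t) (α : ℝ) :
    min 1 (K ^ α) * t ^ α ≤ r ^ α := by
  have htα : 0 ≤ t ^ α := Real.rpow_nonneg ht.le α
  have hK : 0 < K := pos_of_mul_pos_left (ht.trans_le (htr.trans hr)) ht.le
  rcases le_total 0 α with hα | hα
  · exact (mul_le_of_le_one_left htα (min_le_left _ _)).trans (Real.rpow_le_rpow ht.le htr hα)
  · calc min 1 (K ^ α) * t ^ α ≤ K ^ α * t ^ α := mul_le_mul_of_nonneg_right (min_le_right _ _) htα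
      _ = (K * t) ^ α := (Real.mul_rpow hK.le ht.le).symm
      _ ≤ r ^ α := Real.rpow_le_rpow_of_nonpos (ht.trans_le htr) hr hα

/-- The constant `c` in the bound `c x_n ^ α ≤ |x| ^ α` on cuspidal domains in `ℝ^(m+1)`. -/
def cuspWeightConst (m : ℕ) (α : ℝ) : ℝ := min 1 (√(m + 1) ^ α)

theorem cuspWeightConst_pos (m : ℕ) (α : ℝ) : 0 < cuspWeightConst m α :=
  lt_min one_pos (by positivity)

theorem cuspWeightConst_mul_le (hγ : ∀ i, 1 ≤ γ i) (α : ℝ) (hx : x ∈ cuspDomain γ) :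
    cuspWeightConst m α * x (Fin.last m) ^ α ≤ ‖x‖ ^ α :=
  min_one_rpow_mul_rpow_le hx.1.1 (apply_le_norm x _) (norm_le_of_mem_cuspDomain hγ hx) α

end CuspGeometry

section SliceIntegral

variable {m : ℕ}

theorem lintegral_rpow_Ioo {r : ℝ} (hr : -1 < r) :
    ∫⁻ t in Ioo (0 : ℝ) 1, ENNReal.ofReal (t ^ r) = ENNReal.ofReal (1 / (r + 1)) := by
  have hint : IntegrableOn (fun t : ℝ => t ^ r) (Ioc 0 1) :=
    (intervalIntegrable_iff_integrableOn_Ioc_of_le zero_le_one).1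
      (intervalIntegral.intervalIntegrable_rpow' hr)
  have hnonneg : 0 ≤ᵐ[volume.restrict (Ioc (0 : ℝ) 1)] fun t => t ^ r := by
    filter_upwards [ae_restrict_mem measurableSet_Ioc] with t ht using Real.rpow_nonneg ht.1.le r
  rw [restrict_Ioo_eq_restrict_Ioc, ← ofReal_integral_eq_lintegral_ofReal hint hnonneg,
    ← intervalIntegral.integral_of_le zero_le_one, integral_rpow (Or.inl hr), Real.one_rpow,
    Real.zero_rpow (by linarith), sub_zero]

theorem lintegral_euclideanSpace_snoc {G : EuclideanSpace ℝ (Fin (m + 1)) → ℝ≥0∞}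
    (hG : Measurable G) :
    ∫⁻ x, G x =
      ∫⁻ t : ℝ, ∫⁻ y : Fin m → ℝ, G (WithLp.toLp 2 (Fin.snoc (α := fun _ => ℝ) y t)) := by
  let e := (MeasurableEquiv.piFinSuccAbove (fun _ : Fin (m + 1) => ℝ) (Fin.last m)).symm
  have he : MeasurePreserving fun z : ℝ × (Fin m → ℝ) => WithLp.toLp 2 (e z) :=
    (PiLp.volume_preserving_toLp _).comp
      ((volume_preserving_piFinSuccAbove (fun _ : Fin (m + 1) => ℝ) (Fin.last m)).symm _)
  have hsnoc : ∀ t y, e (t, y) = Fin.snoc (α := fun _ => ℝ) y t := fun t y =>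
    Fin.insertNth_last' t y
  rw [← he.lintegral_comp hG, Measure.volume_eq_prod,
    lintegral_prod (fun z => G (WithLp.toLp 2 (e z))) (hG.comp he.measurable).aemeasurable]
  simp only [hsnoc]

theorem setLIntegral_cuspDomain_comp_last (γ : Fin m → ℝ) {g : ℝ → ℝ≥0∞} (hg : Measurable g) :
    ∫⁻ x in cuspDomain γ, g (x (Fin.last m)) =
      ∫⁻ t in Ioo 0 1, ENNReal.ofReal (t ^ ∑ i, γ i) * g t := by
  have hmeas := (isOpen_cuspDomain γ).measurableSet
  have hG : Measurable fun x : EuclideanSpace ℝ (Fin (m + 1)) => g (x (Fin.last m)) :=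
    hg.comp (EuclideanSpace.proj (Fin.last m)).continuous.measurable
  rw [← lintegral_indicator hmeas, lintegral_euclideanSpace_snoc (hG.indicator hmeas),
    ← lintegral_indicator measurableSet_Ioo]
  refine lintegral_congr fun t => ?_
  let box : Set (Fin m → ℝ) := univ.pi fun i => Ioo 0 (t ^ γ i)
  by_cases ht : t ∈ Ioo (0 : ℝ) 1
  · have hslice : ∀ y : Fin m → ℝ, (cuspDomain γ).indicator (fun x => g (x (Fin.last m)))
        (WithLp.toLp 2 (Fin.snoc (α := fun _ => ℝ) y t)) = box.indicator (fun _ => g t) y := by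
      intro y
      have hmem := toLp_snoc_mem_cuspDomain (γ := γ) (y := y) (t := t)
      by_cases hy : y ∈ box
      · rw [indicator_of_mem hy, indicator_of_mem (hmem.2 ⟨ht, hy⟩)]
        exact congrArg g (Fin.snoc_last (α := fun _ => ℝ) t y)
      · rw [indicator_of_notMem hy, indicator_of_notMem fun h => hy (hmem.1 h).2]
    have hvol : volume box = ENNReal.ofReal (t ^ ∑ i, γ i) := by
      simp only [box, Real.volume_pi_Ioo, sub_zero, Real.rpow_sum_of_pos ht.1]
      exact (ENNReal.ofReal_prod_of_nonneg fun i _ => Real.rpow_nonneg ht.1.le _).symm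
    simp_rw [hslice]
    rw [lintegral_indicator_const (.univ_pi fun _ => measurableSet_Ioo), hvol,
      indicator_of_mem ht, mul_comm]
  · have hslice : ∀ y : Fin m → ℝ, (cuspDomain γ).indicator (fun x => g (x (Fin.last m)))
        (WithLp.toLp 2 (Fin.snoc (α := fun _ => ℝ) y t)) = 0 := fun y =>
      indicator_of_notMem (fun h => ht (toLp_snoc_mem_cuspDomain.1 h).1) _
    simp only [hslice, lintegral_zero, indicator_of_notMem ht]

theorem setLIntegral_cuspDomain_last_rpow (γ : Fin m → ℝ) {q : ℝ} (hq : 0 < q + cuspExponent γ) :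
    ∫⁻ x in cuspDomain γ, ENNReal.ofReal (x (Fin.last m) ^ q) =
      ENNReal.ofReal (1 / (q + cuspExponent γ)) := by
  have hexp : q + cuspExponent γ = (∑ i, γ i) + q + 1 := by
    rw [cuspExponent]
    ring
  rw [setLIntegral_cuspDomain_comp_last γ (g := fun t => .ofReal (t ^ q)) (by fun_prop), hexp,
    ← lintegral_rpow_Ioo (by linarith)]
  refine setLIntegral_congr_fun measurableSet_Ioo fun t ht => ?_
  simp only [Real.rpow_add ht.1, ENNReal.ofReal_mul (Real.rpow_nonneg ht.1.le _)]

end SliceIntegral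

section EuclideanNorms

theorem opNorm_le_sqrt_sum_of_sq_apply_le {ι F : Type*} [Fintype ι] [SeminormedAddCommGroup F]
    [NormedSpace ℝ F] {A : F →L[ℝ] EuclideanSpace ℝ ι} {c : ι → ℝ}
    (h : ∀ v i, A v i ^ 2 ≤ c i * ‖v‖ ^ 2) : ‖A‖ ≤ √(∑ i, c i) := by
  refine A.opNorm_le_bound (Real.sqrt_nonneg _) fun v => ?_
  rw [EuclideanSpace.norm_eq, ← Real.sqrt_sq (norm_nonneg v), ← Real.sqrt_mul' _ (sq_nonneg _),
    Finset.sum_mul]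
  exact Real.sqrt_le_sqrt (Finset.sum_le_sum fun i _ =>
    (congrArg (· ^ 2) (Real.norm_eq_abs _)).trans_le ((sq_abs _).trans_le (h v i)))

theorem sq_apply_add_sq_apply_le {ι : Type*} [Fintype ι] (v : EuclideanSpace ℝ ι) {i j : ι}
    (hij : i ≠ j) : v i ^ 2 + v j ^ 2 ≤ ‖v‖ ^ 2 := by
  classical
  rw [EuclideanSpace.real_norm_sq_eq, ← Finset.sum_pair (f := fun k => v k ^ 2) hij]
  exact Finset.sum_le_univ_sum_of_nonneg fun k => sq_nonneg (v k)

end EuclideanNorms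

section PowerShear

variable {m : ℕ}

/-- The map `(x_1, …, x_n) ↦ (x_1 x_n ^ β_1, …, x_{n-1} x_n ^ β_{n-1}, x_n ^ b)`, `n = m + 1`. On
the half-space `0 < x_n` these maps are closed under composition, and contain `cuspMap γ a`. -/
def powerShear (β : Fin m → ℝ) (b : ℝ) (x : EuclideanSpace ℝ (Fin (m + 1))) :
    EuclideanSpace ℝ (Fin (m + 1)) :=
  WithLp.toLp 2 (Fin.snoc (α := fun _ => ℝ)
    (fun i => x i.castSucc * x (Fin.last m) ^ β i) (x (Fin.last m) ^ b))

variable {β β' γ γ' : Fin m → ℝ} {b b' : ℝ} {x : EuclideanSpace ℝ (Fin (m + 1))}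

theorem powerShear_last : powerShear β b x (Fin.last m) = x (Fin.last m) ^ b := by
  simp only [powerShear, Fin.snoc_last]

theorem powerShear_castSucc (i : Fin m) :
    powerShear β b x i.castSucc = x i.castSucc * x (Fin.last m) ^ β i := by
  simp only [powerShear, Fin.snoc_castSucc]

theorem powerShear_powerShear (hx : 0 < x (Fin.last m)) :
    powerShear β' b' (powerShear β b x) = powerShear (fun i => β i + b * β' i) (b * b') x := by
  ext j
  induction j using Fin.lastCases with
  | last => simp only [powerShear_last, Real.rpow_mul hx.le]
  | cast i =>
    simp only [powerShear_castSucc, powerShear_last, Real.rpow_add hx, Real.rpow_mul hx.le,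
      mul_assoc]

theorem powerShear_zero_one : powerShear 0 1 x = x := by
  ext j
  induction j using Fin.lastCases with
  | last => rw [powerShear_last, Real.rpow_one]
  | cast i => rw [powerShear_castSucc, Pi.zero_apply, Real.rpow_zero, mul_one]

theorem mapsTo_powerShear (hb : 0 < b) (hβ : ∀ i, γ i + β i = b * γ' i) :
    MapsTo (powerShear β b) (cuspDomain γ) (cuspDomain γ') := by
  rintro x ⟨⟨h0, h1⟩, hx⟩
  simp only [cuspDomain, mem_ofPred_eq, powerShear_last, powerShear_castSucc]
  refine ⟨⟨Real.rpow_pos_of_pos h0 b, Real.rpow_lt_one h0.le h1 hb⟩, fun i => ?_⟩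
  have hpos := Real.rpow_pos_of_pos h0 (β i)
  refine ⟨mul_pos (hx i).1 hpos, ?_⟩
  rw [← Real.rpow_mul h0.le, ← hβ, Real.rpow_add h0]
  exact mul_lt_mul_of_pos_right (hx i).2 hpos

theorem contDiffAt_powerShear (hx : x (Fin.last m) ≠ 0) : ContDiffAt ℝ ∞ (powerShear β b) x := by
  have hcoord : ∀ j, ContDiffAt ℝ ∞ (fun y : EuclideanSpace ℝ (Fin (m + 1)) => y j) x := fun j =>
    (EuclideanSpace.proj (𝕜 := ℝ) j).contDiff.contDiffAt
  refine contDiffAt_euclidean.2 fun j => ?_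
  induction j using Fin.lastCases with
  | last => simpa only [powerShear_last] using (hcoord _).rpow_const_of_ne hx
  | cast i =>
    simpa only [powerShear_castSucc] using (hcoord _).mul ((hcoord _).rpow_const_of_ne hx)

theorem hasFDerivAt_powerShear_apply (hx : x (Fin.last m) ≠ 0) (j : Fin (m + 1)) :
    HasFDerivAt (fun y => powerShear β b y j)
      ((EuclideanSpace.proj j).comp (fderiv ℝ (powerShear β b) x)) x :=
  (EuclideanSpace.proj (𝕜 := ℝ) j).hasFDerivAt.comp x
    ((contDiffAt_powerShear hx).differentiableAt (by simp)).hasFDerivAt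

theorem fderiv_powerShear_last (hx : x (Fin.last m) ≠ 0) (v : EuclideanSpace ℝ (Fin (m + 1))) :
    fderiv ℝ (powerShear β b) x v (Fin.last m) =
      b * x (Fin.last m) ^ (b - 1) * v (Fin.last m) := by
  have h := ((EuclideanSpace.proj (𝕜 := ℝ) (Fin.last m)).hasFDerivAt (x := x)).rpow_const
    (p := b) (Or.inl hx)
  have h' := hasFDerivAt_powerShear_apply (β := β) (b := b) hx (Fin.last m)
  simp only [powerShear_last] at h'
  exact DFunLike.congr_fun (h'.unique h) v

theorem fderiv_powerShear_castSucc (hx : x (Fin.last m) ≠ 0) (v : EuclideanSpace ℝ (Fin (m + 1)))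
    (i : Fin m) :
    fderiv ℝ (powerShear β b) x v i.castSucc = x (Fin.last m) ^ β i *
      (v i.castSucc + β i * (x i.castSucc / x (Fin.last m)) * v (Fin.last m)) := by
  have h := ((EuclideanSpace.proj (𝕜 := ℝ) i.castSucc).hasFDerivAt (x := x)).mul
    (((EuclideanSpace.proj (𝕜 := ℝ) (Fin.last m)).hasFDerivAt (x := x)).rpow_const
      (p := β i) (Or.inl hx))
  have h' := hasFDerivAt_powerShear_apply (β := β) (b := b) hx i.castSucc
  simp only [powerShear_castSucc] at h'
  calc fderiv ℝ (powerShear β b) x v i.castSucc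
      = x i.castSucc * (β i * x (Fin.last m) ^ (β i - 1) * v (Fin.last m)) +
        x (Fin.last m) ^ β i * v i.castSucc := DFunLike.congr_fun (h'.unique h) v
    _ = _ := by
      rw [Real.rpow_sub_one hx]
      ring

theorem det_fderiv_powerShear (hx : 0 < x (Fin.last m)) :
    (fderiv ℝ (powerShear β b) x).det = b * x (Fin.last m) ^ (b - 1 + ∑ i, β i) := by
  let B := (EuclideanSpace.basisFun (Fin (m + 1)) ℝ).toBasis
  have hentry : ∀ i j, LinearMap.toMatrix B B (fderiv ℝ (powerShear β b) x) i j =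
      fderiv ℝ (powerShear β b) x (EuclideanSpace.single j 1) i := fun i j => by
    simp [B, LinearMap.toMatrix_apply]
  have htri : (LinearMap.toMatrix B B (fderiv ℝ (powerShear β b) x)).BlockTriangular id := by
    intro i j hij
    have hj : j < Fin.last m := lt_of_lt_of_le hij (Fin.le_last i)
    rw [hentry]
    induction i using Fin.lastCases with
    | last => simp [fderiv_powerShear_last hx.ne', hj.ne']
    | cast i => simp [fderiv_powerShear_castSucc hx.ne', hj.ne', (show j < i.castSucc from hij).ne']
  have hne : ∀ i : Fin m, Fin.last m ≠ i.castSucc := fun i => i.castSucc_lt_last.ne'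
  rw [ContinuousLinearMap.det, ← LinearMap.det_toMatrix B, Matrix.det_of_isUpperTriangular htri,
    Fin.prod_univ_castSucc]
  simp only [hentry, fderiv_powerShear_last hx.ne', fderiv_powerShear_castSucc hx.ne',
    PiLp.single_apply, hne, if_true, if_false, mul_zero, add_zero, mul_one]
  rw [← Real.rpow_sum_of_pos hx, mul_left_comm, ← Real.rpow_add hx, add_comm (∑ i, β i)]

theorem sq_fderiv_powerShear_castSucc_le (hx0 : 0 < x (Fin.last m)) (hx1 : x (Fin.last m) ≤ 1)
    {i : Fin m} (hxi : |x i.castSucc| ≤ x (Fin.last m)) (hβ : b - 1 ≤ β i)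
    (v : EuclideanSpace ℝ (Fin (m + 1))) :
    fderiv ℝ (powerShear β b) x v i.castSucc ^ 2 ≤
      (β i ^ 2 + 1) * (x (Fin.last m) ^ (b - 1)) ^ 2 * ‖v‖ ^ 2 := by
  rw [fderiv_powerShear_castSucc hx0.ne', mul_pow]
  set t := x (Fin.last m)
  set k := β i * (x i.castSucc / t)
  have hpow : (t ^ β i) ^ 2 ≤ (t ^ (b - 1)) ^ 2 :=
    pow_le_pow_left₀ (Real.rpow_nonneg hx0.le _) (Real.rpow_le_rpow_of_exponent_ge hx0 hx1 hβ) 2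
  have hk : k ^ 2 ≤ β i ^ 2 := by
    rw [mul_pow]
    refine mul_le_of_le_one_right (sq_nonneg _) ((sq_le_one_iff_abs_le_one _).2 ?_)
    rwa [abs_div, abs_of_pos hx0, div_le_one hx0]
  have hcauchy : (v i.castSucc + k * v (Fin.last m)) ^ 2 ≤
      (k ^ 2 + 1) * (v i.castSucc ^ 2 + v (Fin.last m) ^ 2) := by
    linarith [sq_nonneg (v (Fin.last m) - k * v i.castSucc)]
  calc (t ^ β i) ^ 2 * (v i.castSucc + k * v (Fin.last m)) ^ 2
      ≤ (t ^ (b - 1)) ^ 2 * ((k ^ 2 + 1) * (v i.castSucc ^ 2 + v (Fin.last m) ^ 2)) := by gcongr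
    _ ≤ (t ^ (b - 1)) ^ 2 * ((β i ^ 2 + 1) * ‖v‖ ^ 2) := by
      gcongr
      exact sq_apply_add_sq_apply_le v i.castSucc_lt_last.ne
    _ = (β i ^ 2 + 1) * (t ^ (b - 1)) ^ 2 * ‖v‖ ^ 2 := by ring

theorem norm_fderiv_powerShear_le (hx0 : 0 < x (Fin.last m)) (hx1 : x (Fin.last m) ≤ 1)
    (hx : ∀ i : Fin m, |x i.castSucc| ≤ x (Fin.last m)) (hβ : ∀ i, b - 1 ≤ β i) :
    ‖fderiv ℝ (powerShear β b) x‖ ≤ √((∑ i, β i ^ 2) + m + b ^ 2) * x (Fin.last m) ^ (b - 1) := by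
  set t := x (Fin.last m)
  let c : Fin (m + 1) → ℝ := Fin.snoc (α := fun _ => ℝ) (fun i => β i ^ 2 + 1) (b ^ 2)
  have hrow : ∀ v j, fderiv ℝ (powerShear β b) x v j ^ 2 ≤ c j * (t ^ (b - 1)) ^ 2 * ‖v‖ ^ 2 := by
    intro v j
    induction j using Fin.lastCases with
    | last =>
      rw [fderiv_powerShear_last hx0.ne', mul_pow, mul_pow, show c (Fin.last m) = b ^ 2 from
        Fin.snoc_last (α := fun _ => ℝ) _ _]
      exact mul_le_mul_of_nonneg_left
        (sq_le_sq.2 ((PiLp.norm_apply_le v _).trans (le_abs_self _))) (by positivity)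
    | cast i =>
      rw [show c i.castSucc = β i ^ 2 + 1 from Fin.snoc_castSucc (α := fun _ => ℝ) _ _ i]
      exact sq_fderiv_powerShear_castSucc_le hx0 hx1 (hx i) (hβ i) v
  have hsum : ∑ j, c j = (∑ i, β i ^ 2) + m + b ^ 2 := by
    simp [c, Fin.sum_univ_castSucc, Finset.sum_add_distrib]
  calc ‖fderiv ℝ (powerShear β b) x‖ ≤ √(∑ j, c j * (t ^ (b - 1)) ^ 2) :=
        opNorm_le_sqrt_sum_of_sq_apply_le hrow
    _ = √((∑ i, β i ^ 2) + m + b ^ 2) * t ^ (b - 1) := by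
        rw [← Finset.sum_mul, hsum, Real.sqrt_mul' _ (sq_nonneg _),
          Real.sqrt_sq (Real.rpow_nonneg hx0.le _)]

end PowerShear

section CuspMap

variable {m : ℕ} {γ : Fin m → ℝ} {a : ℝ} {x : EuclideanSpace ℝ (Fin (m + 1))}

theorem cuspMap_last : cuspMap γ a x (Fin.last m) = x (Fin.last m) ^ a := by
  simp only [cuspMap, Fin.snoc_last]

theorem cuspMap_eq_powerShear (hx : 0 < x (Fin.last m)) :
    cuspMap γ a x = powerShear (fun i => a * γ i - 1) a x := by
  refine congrArg (fun y => WithLp.toLp 2 (Fin.snoc (α := fun _ => ℝ) y _)) (funext fun i => ?_)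
  rw [← Real.rpow_mul hx.le, Real.rpow_sub_one hx.ne', mul_comm a]
  ring

theorem cuspMap_eventuallyEq_powerShear (hx : 0 < x (Fin.last m)) :
    cuspMap γ a =ᶠ[nhds x] powerShear (fun i => a * γ i - 1) a :=
  (((EuclideanSpace.proj (𝕜 := ℝ) (Fin.last m)).continuous.tendsto x).eventually
    (lt_mem_nhds hx)).mono fun _ => cuspMap_eq_powerShear

theorem mapsTo_cuspMap (ha : 0 < a) : MapsTo (cuspMap γ a) (baseDomain m) (cuspDomain γ) :=
  (mapsTo_powerShear ha fun i => by ring).congr fun _ hx => (cuspMap_eq_powerShear hx.1.1).symm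

/-- The homeomorphism `φ_a` of `Ω_n` onto `Ω_γ`; its inverse is again a power shear. -/
def cuspDiffeo (γ : Fin m → ℝ) (ha : 0 < a) : OpenPartialHomeomorph
    (EuclideanSpace ℝ (Fin (m + 1))) (EuclideanSpace ℝ (Fin (m + 1))) where
  toFun := cuspMap γ a
  invFun := powerShear (fun i => a⁻¹ - γ i) a⁻¹
  source := baseDomain m
  target := cuspDomain γ
  map_source' := fun _ hx => mapsTo_cuspMap ha hx
  map_target' := fun y hy => mapsTo_powerShear (inv_pos.2 ha) (fun i => by ring) hy
  left_inv' := fun x hx => by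
    rw [cuspMap_eq_powerShear hx.1.1, powerShear_powerShear hx.1.1]
    convert powerShear_zero_one using 2
    · ext i
      simp [mul_sub, ha.ne']
    · exact mul_inv_cancel₀ ha.ne'
  right_inv' := fun y hy => by
    have hpos : 0 < powerShear (fun i => a⁻¹ - γ i) a⁻¹ y (Fin.last m) := by
      rw [powerShear_last]
      exact Real.rpow_pos_of_pos hy.1.1 _
    rw [cuspMap_eq_powerShear hpos, powerShear_powerShear hy.1.1]
    convert powerShear_zero_one using 2
    · ext i
      simp [mul_sub, ha.ne']
    · exact inv_mul_cancel₀ ha.ne'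
  open_source := isOpen_cuspDomain _
  open_target := isOpen_cuspDomain γ
  continuousOn_toFun := fun x hx => ((contDiffAt_powerShear hx.1.1.ne').continuousAt.congr
    (cuspMap_eventuallyEq_powerShear hx.1.1).symm).continuousWithinAt
  continuousOn_invFun := fun y hy =>
    (contDiffAt_powerShear hy.1.1.ne').continuousAt.continuousWithinAt

theorem isSmoothDiffeo_cuspDiffeo (γ : Fin m → ℝ) (ha : 0 < a) :
    IsSmoothDiffeo (cuspDiffeo γ ha) where
  contDiffOn _ hx := ((contDiffAt_powerShear hx.1.1.ne').congr_of_eventuallyEq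
    (cuspMap_eventuallyEq_powerShear hx.1.1)).contDiffWithinAt
  contDiffOn_symm _ hy := (contDiffAt_powerShear hy.1.1.ne').contDiffWithinAt

theorem det_fderiv_cuspMap (hx : 0 < x (Fin.last m)) :
    (fderiv ℝ (cuspMap γ a) x).det = a * x (Fin.last m) ^ (a * cuspExponent γ - (m + 1)) := by
  rw [(cuspMap_eventuallyEq_powerShear hx).fderiv_eq, det_fderiv_powerShear hx]
  congr 2
  simp only [cuspExponent, Finset.sum_sub_distrib, Finset.sum_const, Finset.card_univ,
    Fintype.card_fin, nsmul_eq_mul, mul_one, Finset.mul_sum, mul_add]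
  ring

theorem norm_fderiv_cuspMap_le (hγ : ∀ i, 1 ≤ γ i) (ha : 0 ≤ a) (hx : x ∈ baseDomain m) :
    ‖fderiv ℝ (cuspMap γ a) x‖ ≤
      √((∑ i, (a * γ i - 1) ^ 2) + m + a ^ 2) * x (Fin.last m) ^ (a - 1) := by
  obtain ⟨⟨h0, h1⟩, hxi⟩ := mem_baseDomain.1 hx
  rw [(cuspMap_eventuallyEq_powerShear h0).fderiv_eq]
  exact norm_fderiv_powerShear_le h0 h1.le
    (fun i => (abs_of_pos (hxi i).1).trans_le (hxi i).2.le)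
    fun i => sub_le_sub_right (le_mul_of_one_le_right ha (hγ i)) 1

end CuspMap

section CuspDistortion

variable {m : ℕ} {γ : Fin m → ℝ} {a α p s : ℝ}

theorem enorm_rpow_div_enorm_det_mul_powerWeight {E : Type*} [NormedAddCommGroup E]
    [InnerProductSpace ℝ E] {A : E →L[ℝ] E} {y : E} (hA : A.det ≠ 0) (hy : 0 < ‖y‖) (hp : 0 ≤ p) :
    ‖A‖ₑ ^ p / (‖A.det‖ₑ * (powerWeight α y : ℝ≥0∞)) =
      ENNReal.ofReal (‖A‖ ^ p / (|A.det| * ‖y‖ ^ α)) := by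
  have hw : (powerWeight α y : ℝ≥0∞) = ENNReal.ofReal (‖y‖ ^ α) := by
    rw [powerWeight, ENNReal.ofReal, Real.toNNReal_rpow_of_nonneg (norm_nonneg _), norm_toNNReal]
  rw [hw, Real.enorm_eq_ofReal_abs, ← ofReal_norm,
    ENNReal.ofReal_rpow_of_nonneg (norm_nonneg _) hp, ← ENNReal.ofReal_mul (abs_nonneg _),
    ← ENNReal.ofReal_div_of_pos (mul_pos (abs_pos.2 hA) (Real.rpow_pos_of_pos hy α))]

/-- A bound for the weighted distortion `|Dφ_a|^p / (|J| |φ_a|^α)` of `φ_a` at the points with last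
coordinate `x_n = 1`; at general points it is to be multiplied by a power of `x_n`. -/
def cuspDistortionConst (γ : Fin m → ℝ) (a α p : ℝ) : ℝ :=
  √((∑ i, (a * γ i - 1) ^ 2) + m + a ^ 2) ^ p / (a * cuspWeightConst m α)

theorem cuspDistortionConst_nonneg (ha : 0 < a) : 0 ≤ cuspDistortionConst γ a α p := by
  have := cuspWeightConst_pos m α
  unfold cuspDistortionConst
  positivity

theorem norm_fderiv_cuspMap_rpow_div_le (hγ : ∀ i, 1 ≤ γ i) (ha : 0 < a) (α : ℝ) (hp : 0 ≤ p)
    {x : EuclideanSpace ℝ (Fin (m + 1))} (hx : x ∈ baseDomain m) :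
    ‖fderiv ℝ (cuspMap γ a) x‖ ^ p /
        (|(fderiv ℝ (cuspMap γ a) x).det| * ‖cuspMap γ a x‖ ^ α) ≤
      cuspDistortionConst γ a α p *
        x (Fin.last m) ^ ((m : ℝ) + 1 - p - a * (α + cuspExponent γ - p)) := by
  have h0 := hx.1.1
  have hc := cuspWeightConst_pos m α
  have hweight := cuspWeightConst_mul_le hγ α (mapsTo_cuspMap ha hx)
  rw [cuspMap_last, ← Real.rpow_mul h0.le] at hweight
  rw [det_fderiv_cuspMap h0, cuspDistortionConst]
  set t := x (Fin.last m)
  set C := √((∑ i, (a * γ i - 1) ^ 2) + m + a ^ 2)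
  have hJ : 0 < a * t ^ (a * cuspExponent γ - (m + 1)) := mul_pos ha (Real.rpow_pos_of_pos h0 _)
  rw [abs_of_pos hJ]
  calc ‖fderiv ℝ (cuspMap γ a) x‖ ^ p /
        (a * t ^ (a * cuspExponent γ - (m + 1)) * ‖cuspMap γ a x‖ ^ α)
      ≤ (C * t ^ (a - 1)) ^ p /
        (a * t ^ (a * cuspExponent γ - (m + 1)) * (cuspWeightConst m α * t ^ (a * α))) := by
        gcongr
        exact norm_fderiv_cuspMap_le hγ ha.le hx
    _ = C ^ p / (a * cuspWeightConst m α) *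
        (t ^ ((a - 1) * p) / (t ^ (a * cuspExponent γ - (m + 1)) * t ^ (a * α))) := by
        rw [Real.mul_rpow (Real.sqrt_nonneg _) (Real.rpow_nonneg h0.le _), ← Real.rpow_mul h0.le,
          div_mul_div_comm]
        ring
    _ = C ^ p / (a * cuspWeightConst m α) * t ^ (m + 1 - p - a * (α + cuspExponent γ - p)) := by
        rw [← Real.rpow_add h0, ← Real.rpow_sub h0]
        ring_nf

theorem lintegral_distortion_cuspMap_le (hγ : ∀ i, 1 ≤ γ i) (ha : 0 < a) (α : ℝ)
    (hs : 0 < s) (hsp : s < p)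
    (hd : s * (a * (α + cuspExponent γ - p) + p) < (m + 1) * p) :
    ∫⁻ x in baseDomain m, (‖fderiv ℝ (cuspMap γ a) x‖ₑ ^ p /
        (‖(fderiv ℝ (cuspMap γ a) x).det‖ₑ * (powerWeight α (cuspMap γ a x) : ℝ≥0∞))) ^
          (s / (p - s)) ≤
      ENNReal.ofReal (cuspDistortionConst γ a α p ^ (s / (p - s)) *
        ((p - s) / ((m + 1) * p - s * (a * (α + cuspExponent γ - p) + p)))) := by
  have hps : 0 < p - s := sub_pos.2 hsp
  have hM : 0 ≤ cuspDistortionConst γ a α p := cuspDistortionConst_nonneg ha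
  set M := cuspDistortionConst γ a α p
  set r := s / (p - s) with hr
  have hr0 : 0 ≤ r := (div_pos hs hps).le
  set q := (m : ℝ) + 1 - p - a * (α + cuspExponent γ - p) with hq
  set d := ((m : ℝ) + 1) * p - s * (a * (α + cuspExponent γ - p) + p) with hd'
  have hexp : q * r + cuspExponent (fun _ : Fin m => 1) = d / (p - s) := by
    rw [hr, hq, hd',
      show cuspExponent (fun _ : Fin m => 1) = m + 1 by simp [cuspExponent, add_comm]]
    field_simp
    ring
  have hpointwise : ∀ x ∈ baseDomain m, (‖fderiv ℝ (cuspMap γ a) x‖ₑ ^ p /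
      (‖(fderiv ℝ (cuspMap γ a) x).det‖ₑ * (powerWeight α (cuspMap γ a x) : ℝ≥0∞))) ^ r ≤
      ENNReal.ofReal (M ^ r) * ENNReal.ofReal (x (Fin.last m) ^ (q * r)) := by
    intro x hx
    have hdet : (fderiv ℝ (cuspMap γ a) x).det ≠ 0 :=
      (isSmoothDiffeo_cuspDiffeo γ ha).det_ne_zero hx
    rw [enorm_rpow_div_enorm_det_mul_powerWeight hdet
        (norm_pos_of_mem_cuspDomain (mapsTo_cuspMap ha hx)) (hs.trans hsp).le,
      Real.rpow_mul hx.1.1.le, ← ENNReal.ofReal_rpow_of_nonneg hM hr0,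
      ← ENNReal.ofReal_rpow_of_nonneg (Real.rpow_nonneg hx.1.1.le _) hr0,
      ← ENNReal.mul_rpow_of_nonneg _ _ hr0, ← ENNReal.ofReal_mul hM]
    exact ENNReal.rpow_le_rpow (ENNReal.ofReal_le_ofReal
      (norm_fderiv_cuspMap_rpow_div_le hγ ha α (hs.trans hsp).le hx)) hr0
  have hint : ∫⁻ x in baseDomain m, ENNReal.ofReal (x (Fin.last m) ^ (q * r)) =
      ENNReal.ofReal (1 / (q * r + cuspExponent fun _ : Fin m => 1)) :=
    setLIntegral_cuspDomain_last_rpow _ (hexp ▸ div_pos (sub_pos.2 hd) hps)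
  have hmeas : MeasurableSet (baseDomain m) := (isOpen_cuspDomain _).measurableSet
  refine (setLIntegral_mono' hmeas hpointwise).trans_eq ?_
  rw [lintegral_const_mul' _ _ ENNReal.ofReal_ne_top, hint, hexp, one_div_div,
    ENNReal.ofReal_mul (Real.rpow_nonneg hM _)]

theorem distortionNorm_cuspMap_le (hγ : ∀ i, 1 ≤ γ i) (ha : 0 < a) (α : ℝ)
    (hs : 0 < s) (hsp : s < p)
    (hd : s * (a * (α + cuspExponent γ - p) + p) < (m + 1) * p) :
    distortionNorm p s (baseDomain m) (powerWeight α) (cuspMap γ a) ≤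
      ENNReal.ofReal
        (√((∑ i, (a * γ i - 1) ^ 2) + m + a ^ 2) / (a * cuspWeightConst m α) ^ (1 / p) *
          ((p - s) / ((m + 1) * p - s * (a * (α + cuspExponent γ - p) + p))) ^
            ((p - s) / (p * s))) := by
  have hp : 0 < p := hs.trans hsp
  have hps : 0 < p - s := sub_pos.2 hsp
  have hc := cuspWeightConst_pos m α
  have hM : 0 ≤ cuspDistortionConst γ a α p := cuspDistortionConst_nonneg ha
  have hroot : (cuspDistortionConst γ a α p ^ (s / (p - s))) ^ ((p - s) / (p * s)) =
      √((∑ i, (a * γ i - 1) ^ 2) + m + a ^ 2) / (a * cuspWeightConst m α) ^ (1 / p) := by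
    rw [← Real.rpow_mul hM, show s / (p - s) * ((p - s) / (p * s)) = 1 / p by field_simp,
      cuspDistortionConst, Real.div_rpow (by positivity) (by positivity),
      ← Real.rpow_mul (Real.sqrt_nonneg _), mul_one_div_cancel hp.ne', Real.rpow_one]
  set Q := (p - s) / ((m + 1) * p - s * (a * (α + cuspExponent γ - p) + p))
  have hQ : 0 ≤ Q := (div_pos hps (sub_pos.2 hd)).le
  calc distortionNorm p s (baseDomain m) (powerWeight α) (cuspMap γ a)
      = (∫⁻ x in baseDomain m, (‖fderiv ℝ (cuspMap γ a) x‖ₑ ^ p /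
          (‖(fderiv ℝ (cuspMap γ a) x).det‖ₑ * (powerWeight α (cuspMap γ a x) : ℝ≥0∞))) ^
            (s / (p - s))) ^ ((p - s) / (p * s)) :=
        (isSmoothDiffeo_cuspDiffeo γ ha).distortionNorm_eq p s (powerWeight α)
    _ ≤ ENNReal.ofReal (cuspDistortionConst γ a α p ^ (s / (p - s)) * Q) ^
          ((p - s) / (p * s)) :=
        ENNReal.rpow_le_rpow (lintegral_distortion_cuspMap_le hγ ha α hs hsp hd) (by positivity)
    _ = _ := by
        rw [ENNReal.ofReal_rpow_of_nonneg (by positivity) (by positivity),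
          Real.mul_rpow (by positivity) hQ, hroot]

theorem powerWeight_ne_zero_of_mem_cuspDomain {y : EuclideanSpace ℝ (Fin (m + 1))}
    (hy : y ∈ cuspDomain γ) : powerWeight α y ≠ 0 :=
  (NNReal.rpow_pos (norm_pos_of_mem_cuspDomain hy)).ne'

end CuspDistortion

end

theorem lt_and_mul_lt_of_lt_div {n p b a s : ℝ} (hp : 0 < p) (hb : 0 < b) (ha : 0 < a)
    (hab : (n - p) / b < a) (hs : s < n * p / (a * b + p)) : s < p ∧ s * (a * b + p) < n * p := by
  have hD : 0 < a * b + p := by positivity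
  have hn : n < a * b + p := sub_lt_iff_lt_add.1 ((div_lt_iff₀ hb).1 hab)
  refine ⟨hs.trans ((div_lt_iff₀ hD).2 ?_), (lt_div_iff₀ hD).1 hs⟩
  exact (mul_comm n p).trans_lt (mul_lt_mul_of_pos_left hn hp)

theorem theorem2p2_general (m : ℕ) (α : ℝ) :
    ∃ c : ℝ, 0 < c ∧ ∀ γ : Fin m → ℝ, (∀ i, 1 ≤ γ i) → ∀ a : ℝ, 0 < a →
      (IsLipschitzDomain (baseDomain m) ∧ Convex ℝ (baseDomain m) ∧
        Bornology.IsBounded (cuspDomain γ)) ∧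
      LuzinN (baseDomain m) (cuspMap γ a) ∧
      ∀ p s : ℝ, 1 < s → s < p →
        s * (a * (α + cuspExponent γ - p) + p) < ((m : ℝ) + 1) * p →
        IsWeightedQuasiconformal p s (powerWeight α) (baseDomain m) (cuspDomain γ)
          (cuspMap γ a) ∧
        compositionNorm p s (baseDomain m) (cuspDomain γ) (powerWeight α) (cuspMap γ a) ≤
          distortionNorm p s (baseDomain m) (powerWeight α) (cuspMap γ a) ∧
        distortionNorm p s (baseDomain m) (powerWeight α) (cuspMap γ a) ≤
          ENNReal.ofReal
            (√((∑ i, (a * γ i - 1) ^ 2) + (m : ℝ) + a ^ 2) / (a * c) ^ (1 / p) *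
              ((p - s) / (((m : ℝ) + 1) * p - s * (a * (α + cuspExponent γ - p) + p))) ^
                ((p - s) / (p * s))) := by
  refine ⟨cuspWeightConst m α, cuspWeightConst_pos m α, fun γ hγ a ha => ?_⟩
  have hφ := isSmoothDiffeo_cuspDiffeo γ ha
  have hbase := isLipschitzDomain_baseDomain m
  refine ⟨⟨hbase, convex_baseDomain m, isBounded_cuspDomain fun i => zero_le_one.trans (hγ i)⟩,
    hφ.luzinN, fun p s hs hsp hd => ?_⟩
  have hbound := distortionNorm_cuspMap_le hγ ha α (one_pos.trans hs) hsp hd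
  have hfin := hbound.trans_lt ENNReal.ofReal_lt_top
  have hw0 : ∀ y ∈ cuspDomain γ, powerWeight α y ≠ 0 := fun _ =>
    powerWeight_ne_zero_of_mem_cuspDomain
  exact ⟨hφ.isWeightedQuasiconformal hs hsp hw0 hbase.1.2 hfin,
    hφ.compositionNorm_le_distortionNorm (one_pos.trans hs) hsp (measurable_nnnorm.pow_const α)
      hw0 hfin, hbound⟩

theorem theorem2p2 (m : ℕ) (hm : 1 ≤ m) (γ : Fin m → ℝ) (hγ : ∀ i, 1 ≤ γ i) (α a : ℝ) :
    ∃ c : ℝ, 0 < c ∧ ∀ p : ℝ, 1 < p → p < α + cuspExponent γ →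
      -((m : ℝ) + 1) < α → α < ((m : ℝ) + 1) * (p - 1) →
      max 0 (((m : ℝ) + 1 - p) / (α + cuspExponent γ - p)) < a →
      a < p * (m : ℝ) / (α + cuspExponent γ - p) →
      (IsLipschitzDomain (baseDomain m) ∧ Convex ℝ (baseDomain m) ∧
        Bornology.IsBounded (cuspDomain γ)) ∧
      LuzinN (baseDomain m) (cuspMap γ a) ∧
      ∀ s : ℝ, 1 < s → s < ((m : ℝ) + 1) * p / (a * (α + cuspExponent γ - p) + p) →
        IsWeightedQuasiconformal p s (powerWeight α) (baseDomain m) (cuspDomain γ)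
          (cuspMap γ a) ∧
        compositionNorm p s (baseDomain m) (cuspDomain γ) (powerWeight α) (cuspMap γ a) ≤
          distortionNorm p s (baseDomain m) (powerWeight α) (cuspMap γ a) ∧
        distortionNorm p s (baseDomain m) (powerWeight α) (cuspMap γ a) ≤
          ENNReal.ofReal
            (Real.sqrt ((∑ i, (a * γ i - 1) ^ 2) + (m : ℝ) + a ^ 2) / (a * c) ^ (1 / p) *
              ((p - s) / (((m : ℝ) + 1) * p - s * (a * (α + cuspExponent γ - p) + p))) ^
                ((p - s) / (p * s))) := by
  obtain ⟨c, hc, h⟩ := theorem2p2_general m α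
  refine ⟨c, hc, fun p hp hpα _ _ hmax _ => ?_⟩
  obtain ⟨ha, hpa⟩ := max_lt_iff.1 hmax
  obtain ⟨hdom, hN, hmap⟩ := h γ hγ a ha
  refine ⟨hdom, hN, fun s hs hsu => ?_⟩
  obtain ⟨hsp, hd⟩ := lt_and_mul_lt_of_lt_div (one_pos.trans hp) (sub_pos.2 hpα) ha hpa hsu
  exact hmap p s hs hsp hd
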